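/- **Proposition (IDS and eigenfunctions of the $(3.6)^2$ Kagome tiling).** Let $G=(\mathcal V,\mathcal E)$ be the graph of the $(3.6)^2$ (Kagome) tiling of the plane with edge length $1$. Explicitly, with $e_1=(1,0)$ and $e_2=(\tfrac12,\tfrac{\sqrt3}2)$, put $\mathcal V=(\mathbb Z e_1+\mathbb Z e_2)\setminus(2\mathbb Z e_1+2\mathbb Z e_2)$, two vertices being adjacent iff their distance is $1$. The hexagons of the tiling are centred at the points of $2\mathbb Z e_1+2\mathbb Z e_2$, and the vertices of a hexagon are the six vertices at distance $1$ from its centre. The group $\mathbb Z^2$ acts by the translations $T_\gamma v=v+2\gamma_1e_1+2\gamma_2e_2$; let $Q$ be any finite fundamental domain of this action (so $|Q|=3$). Let $\Delta$ be the bounded self-adjoint operator on $\ell^2(\mathcal V)$ (complex-valued functions) given by $$(\Delta f)(v)=f(v)-\frac14\sum_{w\sim v}f(w),$$ and let $N(E)=\frac1{|Q|}\operatorname{Tr}\bigl(\chi_Q\,\chi_{(-\infty,E]}(\Delta)\bigr)$, $E\in\mathbb R$, be its integrated density of states. For $\theta\in\mathbb T^2=\mathbb R^2/(2\pi\mathbb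 Z)^2$ put $$\lambda_{1}^\theta=\tfrac14\Bigl(3-\sqrt{3+2(\cos\theta_1+\cos\theta_2+\cos(\theta_1-\theta_2))}\Bigr),\quad \lambda_{2}^\theta=\tfrac14\Bigl(3+\sqrt{3+2(\cos\theta_1+\cos\theta_2+\cos(\theta_1-\theta_2))}\Bigr),\quad \lambda_3^\theta=\tfrac32 .$$ These are the eigenvalues, counted with multiplicity, of the operator $\Delta^\theta$ which acts by the same formula as $\Delta$ on the three-dimensional space of functions $f:\mathcal V\to\mathbb C$ with $f(T_\gamma v)=e^{i\langle\theta,\gamma\rangle}f(v)$ for all $\gamma\in\mathbb Z^2$, $v\in\mathcal V$. Then the following hold. 1. For all $E\in\mathbb R$, with $I_E(a,b)=\displaystyle\int_a^b\frac{\arccos\left(\frac{4E^2-6E+2}{t}-t\right)}{\sqrt{1-t^2}}\,\mathrm dt$, $$N(E)=\frac1{3(2\pi)^2}\sum_{k=1}^3\operatorname{Vol}\{\theta\in\mathbb T^2:\lambda_k^\theta\le E\}=\begin{cases}0&\text{if }E<0,\\ \frac{2}{3\pi^2}\,I_E(1-2E,\,1)&\text{if }0\le E<\frac12,\\ \frac13-\frac{2}{3\pi^2}\,I_E(2E-2,\,1-2E)&\text{if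 }\frac12\le E<\frac34,\\ \frac13+\frac{2}{3\pi^2}\,I_E(1-2E,\,2E-2)&\text{if }\frac34\le E<1,\\ \frac23-\frac{2}{3\pi^2}\,I_E(2E-2,\,1)&\text{if }1\le E<\frac32,\\ 1&\text{if }\frac32\le E.\end{cases}$$ In particular $\lim_{E\nearrow3/2}N(E)=\frac23$ and $N(\frac32)=1$, so that $N$ has a jump of size $\frac13$ at $E=\frac32$. 2. For each hexagon $H$ there is, up to scalar multiples, exactly one eigenfunction of $\Delta$ with support on the vertices of $H$. It has eigenvalue $\frac32$ and is a multiple of a function $\varphi_H$ which takes the values $1$ and $-1$ in alternating order at the vertices of $H$ and vanishes elsewhere. 3. Every $\ell^2$-eigenfunction of $\Delta$ has eigenvalue $\frac32$ and is a (finite or infinite) linear combination of the functions $\varphi_H$: it belongs to the closed linear span of the $\varphi_H$ in $\ell^2(\mathcal V)$, and it can be written pointwise as a locally finite sum $f(v)=\sum_H a_H\varphi_H(v)$ with coefficients $a_H\in\mathbb C$. -/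

import Mathlib

open scoped lp

noncomputable section

namespace Kagome

/-! ### The combinatorial Laplacian and the integrated density of states -/

section General

variable {V : Type*}

/-- The combinatorial Laplacian `(Δ f)(v) = f(v) - (1 / |v|) ∑_{w ∼ v} f(w)` acting on all complex
functions on the vertices of a locally finite graph. -/
def laplacian (G : SimpleGraph V) [G.LocallyFinite] : (V → ℂ) →ₗ[ℂ] (V → ℂ) where
  toFun f v := f v - (1 / (G.degree v : ℂ)) * ∑ w ∈ G.neighborFinset v, f w
  map_add' f g := by
    ext v
    simp only [Pi.add_apply, Finset.sum_add_distrib]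
    ring
  map_smul' c f := by
    ext v
    simp only [Pi.smul_apply, smul_eq_mul, RingHom.id_apply, ← Finset.mul_sum]
    ring

theorem laplacian_apply (G : SimpleGraph V) [G.LocallyFinite] (f : V → ℂ) (v : V) :
    laplacian G f v = f v - (1 / (G.degree v : ℂ)) * ∑ w ∈ G.neighborFinset v, f w := rfl

theorem norm_laplacian_sq_le (G : SimpleGraph V) [G.LocallyFinite] (f : V → ℂ) (v : V) :
    ‖laplacian G f v‖ ^ 2 ≤ 2 * ‖f v‖ ^ 2 + 2 * ∑ w ∈ G.neighborFinset v, ‖f w‖ ^ 2 := by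
  have key : ‖(1 / (G.degree v : ℂ)) * ∑ w ∈ G.neighborFinset v, f w‖ ^ 2
      ≤ ∑ w ∈ G.neighborFinset v, ‖f w‖ ^ 2 := by
    have hS : 0 ≤ ∑ w ∈ G.neighborFinset v, ‖f w‖ ^ 2 := Finset.sum_nonneg fun _ _ => sq_nonneg _
    rcases Nat.eq_zero_or_pos (G.degree v) with h0 | hpos
    · simpa [h0] using hS
    · have hd : (1 : ℝ) ≤ (G.degree v : ℝ) := by exact_mod_cast hpos
      have h1 : ‖∑ w ∈ G.neighborFinset v, f w‖ ^ 2
          ≤ (G.degree v : ℝ) * ∑ w ∈ G.neighborFinset v, ‖f w‖ ^ 2 := by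
        calc ‖∑ w ∈ G.neighborFinset v, f w‖ ^ 2
            ≤ (∑ w ∈ G.neighborFinset v, ‖f w‖) ^ 2 := by gcongr; exact norm_sum_le _ _
          _ ≤ _ := sq_sum_le_card_mul_sum_sq
      rw [norm_mul, mul_pow, norm_div, norm_one, Complex.norm_natCast]
      calc (1 / (G.degree v : ℝ)) ^ 2 * ‖∑ w ∈ G.neighborFinset v, f w‖ ^ 2
          ≤ (1 / (G.degree v : ℝ)) ^ 2 *
            ((G.degree v : ℝ) * ∑ w ∈ G.neighborFinset v, ‖f w‖ ^ 2) := by gcongr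
        _ = (1 / (G.degree v : ℝ)) * ∑ w ∈ G.neighborFinset v, ‖f w‖ ^ 2 := by field_simp
        _ ≤ 1 * ∑ w ∈ G.neighborFinset v, ‖f w‖ ^ 2 := by
            gcongr
            exact (div_le_one (by linarith)).2 hd
        _ = _ := one_mul _
  rw [laplacian_apply]
  have h2 := norm_sub_le (f v) ((1 / (G.degree v : ℂ)) * ∑ w ∈ G.neighborFinset v, f w)
  set y := (1 / (G.degree v : ℂ)) * ∑ w ∈ G.neighborFinset v, f w
  nlinarith [norm_nonneg (f v - y), norm_nonneg (f v), norm_nonneg y, sq_nonneg (‖f v‖ - ‖y‖)]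

theorem sum_norm_laplacian_sq_le (G : SimpleGraph V) [G.LocallyFinite] (D : ℕ)
    (hD : ∀ v, G.degree v ≤ D) (f : ℓ²(V, ℂ)) (s : Finset V) :
    ∑ v ∈ s, ‖laplacian G f v‖ ^ (2 : ENNReal).toReal
      ≤ (Real.sqrt (2 + 2 * D) * ‖f‖) ^ (2 : ENNReal).toReal := by
  classical
  have hs : ∀ t : Finset V, ∑ v ∈ t, ‖f v‖ ^ 2 ≤ ‖f‖ ^ 2 := by
    intro t
    have := lp.sum_rpow_le_norm_rpow (p := 2) (by norm_num) f t
    simpa using this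
  have hsw : ∑ v ∈ s, ∑ w ∈ G.neighborFinset v, ‖f w‖ ^ 2 ≤ D * ‖f‖ ^ 2 := by
    set t := s.biUnion fun v => G.neighborFinset v with ht
    calc ∑ v ∈ s, ∑ w ∈ G.neighborFinset v, ‖f w‖ ^ 2
        = ∑ w ∈ t, ∑ v ∈ s.filter (fun v => G.Adj v w), ‖f w‖ ^ 2 := by
          apply Finset.sum_comm'
          intro v w
          simp only [ht, Finset.mem_biUnion, SimpleGraph.mem_neighborFinset, Finset.mem_filter]
          constructor
          · rintro ⟨h1, h2⟩
            exact ⟨⟨h1, h2⟩, v, h1, h2⟩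
          · rintro ⟨⟨h1, h2⟩, -⟩
            exact ⟨h1, h2⟩
      _ ≤ ∑ w ∈ t, (D : ℝ) * ‖f w‖ ^ 2 := by
          apply Finset.sum_le_sum
          intro w _
          rw [Finset.sum_const, nsmul_eq_mul]
          have hc : (s.filter (fun v => G.Adj v w)).card ≤ D := by
            refine le_trans (Finset.card_le_card ?_) (hD w)
            intro v hv
            rw [SimpleGraph.mem_neighborFinset]
            exact (Finset.mem_filter.1 hv).2.symm
          gcongr
      _ = D * ∑ w ∈ t, ‖f w‖ ^ 2 := by rw [Finset.mul_sum]
      _ ≤ D * ‖f‖ ^ 2 := by gcongr; exact hs t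
  have h2 : (2 : ENNReal).toReal = ((2 : ℕ) : ℝ) := by norm_num
  simp only [h2, Real.rpow_natCast]
  rw [mul_pow, Real.sq_sqrt (by positivity)]
  calc ∑ v ∈ s, ‖laplacian G f v‖ ^ 2
      ≤ ∑ v ∈ s, (2 * ‖f v‖ ^ 2 + 2 * ∑ w ∈ G.neighborFinset v, ‖f w‖ ^ 2) :=
        Finset.sum_le_sum fun v _ => norm_laplacian_sq_le G f v
    _ = 2 * ∑ v ∈ s, ‖f v‖ ^ 2 + 2 * ∑ v ∈ s, ∑ w ∈ G.neighborFinset v, ‖f w‖ ^ 2 := by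
        rw [Finset.sum_add_distrib, Finset.mul_sum, Finset.mul_sum]
    _ ≤ (2 + 2 * D) * ‖f‖ ^ 2 := by nlinarith [hs s, hsw]

/-- The Laplacian as a bounded operator on `ℓ²(V)`, for a graph with bounded vertex degree. -/
def laplacianL2 (G : SimpleGraph V) [G.LocallyFinite] (D : ℕ) (hD : ∀ v, G.degree v ≤ D) :
    ℓ²(V, ℂ) →L[ℂ] ℓ²(V, ℂ) :=
  LinearMap.mkContinuous
    { toFun := fun f => ⟨laplacian G f, memℓp_gen' (sum_norm_laplacian_sq_le G D hD f)⟩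
      map_add' := fun f g => Subtype.ext ((laplacian G).map_add f g)
      map_smul' := fun c f => Subtype.ext ((laplacian G).map_smul c f) }
    (Real.sqrt (2 + 2 * D))
    (fun f => lp.norm_le_of_forall_sum_le (by norm_num) (by positivity)
      (sum_norm_laplacian_sq_le G D hD f))

theorem laplacianL2_apply (G : SimpleGraph V) [G.LocallyFinite] (D : ℕ)
    (hD : ∀ v, G.degree v ≤ D) (f : ℓ²(V, ℂ)) (v : V) :
    laplacianL2 G D hD f v
      = f v - (1 / (G.degree v : ℂ)) * ∑ w ∈ G.neighborFinset v, f w := rfl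

/-- The spectral projector `χ_{(-∞, E]}(A)` of a bounded self-adjoint operator `A` on a Hilbert
space: the orthogonal projection onto the kernel of the positive part `(A - E)₊` of `A - E`. -/
def spectralProjector {H : Type*} [NormedAddCommGroup H] [InnerProductSpace ℂ H]
    [CompleteSpace H] (A : H →L[ℂ] H) (E : ℝ) : H →L[ℂ] H :=
  (cfc (fun x : ℝ => max (x - E) 0) A : H →L[ℂ] H).ker.starProjection

/-- `|Q|⁻¹ Tr (χ_Q χ_{(-∞, E]}(A))`, the trace being computed in the orthonormal basis of the
functions `δ_v`: only those with `v ∈ Q` contribute, and `v ∈ Q` contributes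
`⟨δ_v, χ_{(-∞, E]}(A) δ_v⟩`. -/
def densityOfStates [DecidableEq V] (A : ℓ²(V, ℂ) →L[ℂ] ℓ²(V, ℂ)) (Q : Finset V) (E : ℝ) : ℝ :=
  (∑ v ∈ Q, inner ℂ (lp.single 2 v (1 : ℂ) : ℓ²(V, ℂ))
    (spectralProjector A E (lp.single 2 v (1 : ℂ)))).re / (Q.card : ℝ)

end General

/-! ### The Kagome lattice

Points of the plane are written in the coordinates `(x, y) ↦ x e₁ + y e₂` with unit vectors
`e₁ = (1, 0)` and `e₂ = (1/2, √3/2)`. The hexagons of the `(3.6)²` tiling with edge length `1`, one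
of them centred at the origin, have as centres the points of `2ℤ e₁ + 2ℤ e₂`, and the vertices of
the tiling are the other points of `ℤ e₁ + ℤ e₂`. -/

/-- A vertex `(s, γ)` is the translate by `γ.1 ω₁ + γ.2 ω₂`, where `ω₁ = 2 e₁` and `ω₂ = 2 e₂`, of
one of the three vertices (`s = 0, 1, 2`) at the angles `60°, 120°, 180°` of the hexagon around
the origin. -/
abbrev Vertex : Type := Fin 3 × (ℤ × ℤ)

/-- The coordinates of the three vertices in the fundamental cell. -/
def offset : Fin 3 → ℤ × ℤ := ![(0, 1), (-1, 1), (-1, 0)]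

/-- The coordinates of a vertex in the basis `e₁, e₂`. -/
def position (v : Vertex) : ℤ × ℤ :=
  ((offset v.1).1 + 2 * v.2.1, (offset v.1).2 + 2 * v.2.2)

/-- The squared Euclidean length `|x e₁ + y e₂|² = x² + x y + y²`. -/
def sqLength (p : ℤ × ℤ) : ℤ := p.1 ^ 2 + p.1 * p.2 + p.2 ^ 2

/-- The Kagome graph: two vertices are adjacent iff their Euclidean distance is `1`. -/
def graph : SimpleGraph Vertex where
  Adj v w := sqLength (position v - position w) = 1
  symm := ⟨fun v w h => by
    have e : sqLength (position w - position v) = sqLength (position v - position w) := by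
      simp only [sqLength, Prod.fst_sub, Prod.snd_sub]
      ring
    rw [e]
    exact h⟩
  loopless := ⟨fun v h => by simp [sqLength] at h⟩

/-- The action `T_γ` of `ℤ²` on the vertices by translations. -/
def translate (γ : ℤ × ℤ) (v : Vertex) : Vertex := (v.1, v.2 + γ)

/-- `Q` is a fundamental domain of the translation action: every vertex is moved into `Q` by
exactly one translation. -/
def IsFundamentalDomain (Q : Finset Vertex) : Prop := ∀ v : Vertex, ∃! γ : ℤ × ℤ, translate γ v ∈ Q

theorem sqLength_eq_one_iff (x y : ℤ) : sqLength (x, y) = 1 ↔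
    (x = 1 ∧ y = 0) ∨ (x = 0 ∧ y = 1) ∨ (x = -1 ∧ y = 1) ∨
    (x = -1 ∧ y = 0) ∨ (x = 0 ∧ y = -1) ∨ (x = 1 ∧ y = -1) := by
  constructor
  · intro h
    simp only [sqLength] at h
    have h1 : x ≤ 1 := by nlinarith [sq_nonneg (x + 2 * y)]
    have h2 : -1 ≤ x := by nlinarith [sq_nonneg (x + 2 * y)]
    have h3 : y ≤ 1 := by nlinarith [sq_nonneg (2 * x + y)]
    have h4 : -1 ≤ y := by nlinarith [sq_nonneg (2 * x + y)]
    interval_cases x <;> interval_cases y <;> simp_all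
  · rintro (⟨rfl, rfl⟩ | ⟨rfl, rfl⟩ | ⟨rfl, rfl⟩ | ⟨rfl, rfl⟩ | ⟨rfl, rfl⟩ | ⟨rfl, rfl⟩) <;>
      norm_num [sqLength]

/-- The four neighbours of a vertex. -/
def neighbours : Vertex → Finset Vertex
  | (0, m, n) => {(1, m, n), (1, m + 1, n), (2, m + 1, n), (2, m, n + 1)}
  | (1, m, n) => {(0, m, n), (0, m - 1, n), (2, m, n), (2, m, n + 1)}
  | (2, m, n) => {(0, m - 1, n), (0, m, n - 1), (1, m, n), (1, m, n - 1)}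

theorem adj_iff_mem_neighbours (v w : Vertex) : graph.Adj v w ↔ w ∈ neighbours v := by
  obtain ⟨s, m, n⟩ := v
  obtain ⟨t, p, q⟩ := w
  change sqLength (_, _) = 1 ↔ _
  rw [sqLength_eq_one_iff]
  fin_cases s <;> fin_cases t <;> simp [neighbours, position, offset] <;> omega

theorem card_neighbours (v : Vertex) : (neighbours v).card = 4 := by
  obtain ⟨s, m, n⟩ := v
  fin_cases s
  all_goals
    simp only [neighbours]
    rw [Finset.card_insert_of_notMem, Finset.card_insert_of_notMem,
      Finset.card_insert_of_notMem, Finset.card_singleton]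
    all_goals
      simp only [Finset.mem_insert, Finset.mem_singleton, Prod.mk.injEq, not_or]
      grind

instance graphLocallyFinite : graph.LocallyFinite := fun v =>
  Fintype.ofFinset (neighbours v) fun w => (adj_iff_mem_neighbours v w).symm

theorem degree_eq_four (v : Vertex) : graph.degree v = 4 := by
  rw [← card_neighbours v, ← SimpleGraph.card_neighborFinset_eq_degree]
  congr 1
  ext w
  rw [SimpleGraph.mem_neighborFinset, adj_iff_mem_neighbours]

/-- The Laplacian `Δ` of the Kagome lattice, a bounded operator on `ℓ²`. -/
def Δ : ℓ²(Vertex, ℂ) →L[ℂ] ℓ²(Vertex, ℂ) :=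
  laplacianL2 graph 4 fun v => (degree_eq_four v).le

/-- `Δ` is self-adjoint, so that its continuous functional calculus is the genuine one. -/
theorem isSelfAdjoint_laplacian : IsSelfAdjoint Δ := by
  rw [ContinuousLinearMap.isSelfAdjoint_iff']
  ext f v
  have h1 : ∀ g : ℓ²(Vertex, ℂ), inner ℂ (lp.single 2 v (1 : ℂ) : ℓ²(Vertex, ℂ)) g = g v := by
    intro g
    rw [lp.inner_single_left]
    simp
  have h2 : Δ (lp.single 2 v (1 : ℂ)) = (lp.single 2 v (1 : ℂ) : ℓ²(Vertex, ℂ))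
      - (1 / 4 : ℂ) • ∑ w ∈ graph.neighborFinset v, lp.single 2 w (1 : ℂ) := by
    ext u
    rw [Δ, laplacianL2_apply, degree_eq_four]
    rw [lp.coeFn_sub, Pi.sub_apply, lp.coeFn_smul, Pi.smul_apply, lp.coeFn_sum, Finset.sum_apply]
    have h3 : v ∈ graph.neighborFinset u ↔ u ∈ graph.neighborFinset v := by
      rw [SimpleGraph.mem_neighborFinset, SimpleGraph.mem_neighborFinset, graph.adj_comm]
    simp [Pi.single_apply]
    exact if_congr h3 rfl rfl
  rw [← h1, ContinuousLinearMap.adjoint_inner_right, h2, inner_sub_left, inner_smul_left,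
    sum_inner, h1, Δ, laplacianL2_apply, degree_eq_four]
  congr 2
  · rw [map_div₀, map_one, Complex.conj_ofNat]
    norm_num
  · refine Finset.sum_congr rfl fun w _ => ?_
    rw [lp.inner_single_left]
    simp

/-- The integrated density of states of the Kagome lattice, computed with the fundamental
domain `Q`. -/
def ids (Q : Finset Vertex) (E : ℝ) : ℝ := densityOfStates Δ Q E

/-- The `θ`-quasiperiodic functions: `f (T_γ v) = exp (i ⟨θ, γ⟩) f v`. -/
def quasiperiodic (θ : ℝ × ℝ) : Submodule ℂ (Vertex → ℂ) where
  carrier := {f | ∀ (γ : ℤ × ℤ) (v : Vertex),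
    f (translate γ v) = Complex.exp (Complex.I * (θ.1 * γ.1 + θ.2 * γ.2)) * f v}
  zero_mem' := by
    intro γ v
    simp
  add_mem' := by
    intro f g hf hg γ v
    simp only [Pi.add_apply, hf γ v, hg γ v]
    ring
  smul_mem' := by
    intro c f hf γ v
    simp only [Pi.smul_apply, smul_eq_mul, hf γ v]
    ring

/-- The eigenspace for the eigenvalue `E` of the `θ`-pseudoperiodic Laplacian `Δ^θ`, which acts as
the Laplacian on the `θ`-quasiperiodic functions. -/
def floquetEigenspace (θ : ℝ × ℝ) (E : ℝ) : Submodule ℂ (Vertex → ℂ) :=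
  quasiperiodic θ ⊓ Module.End.eigenspace (laplacian graph) (E : ℂ)

/-- The three band functions `λ_k^θ`. -/
def band (k : Fin 3) (θ : ℝ × ℝ) : ℝ :=
  ![(3 - √(3 + 2 * (Real.cos θ.1 + Real.cos θ.2 + Real.cos (θ.1 - θ.2)))) / 4,
    (3 + √(3 + 2 * (Real.cos θ.1 + Real.cos θ.2 + Real.cos (θ.1 - θ.2)))) / 4,
    3 / 2] k

/-- `Vol {θ ∈ 𝕋² : λ_k^θ ≤ E}`, the torus `𝕋² = ℝ² / (2πℤ)²` being represented by `[0, 2π)²`. -/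
def bandVolume (k : Fin 3) (E : ℝ) : ℝ :=
  MeasureTheory.volume.real
    {θ : ℝ × ℝ | θ ∈ Set.Ico 0 (2 * Real.pi) ×ˢ Set.Ico 0 (2 * Real.pi) ∧ band k θ ≤ E}

/-- The integral `∫_a^b arccos ((4 E² - 6 E + 2) / t - t) / √(1 - t²) dt`. -/
def arccosIntegral (E a b : ℝ) : ℝ :=
  ∫ t in a..b, Real.arccos ((4 * E ^ 2 - 6 * E + 2) / t - t) / √(1 - t ^ 2)

/-- The vertex set of the hexagon centred at `2 c.1 e₁ + 2 c.2 e₂`: the vertices at distance `1`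
from the centre. -/
def hexagon (c : ℤ × ℤ) : Set Vertex :=
  {v | sqLength (position v - (2 * c.1, 2 * c.2)) = 1}

end Kagome

end

/-! Floquet theory: a quasiperiodic function is determined by its three values in a cell, and on
these `Δ` acts as the Hermitian matrix `bloch θ`, whose characteristic polynomial splits with roots
`band k θ` (`charpoly_bloch`). Writing `δ_v` as an average of quasiperiodic functions over the torus
gives the moments of the density of states as integrals of `∑ k, band k θ ^ n`. Weierstrass
approximation passes from powers to continuous functions (`cellTrace_functionOf`), and continuous
ramps converging to the indicator of `(-∞, E]` give the spectral projector
(`ids_eq_sum_bandVolume`).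

For the explicit formulas, the dispersion relation is `1 + 4 * profile`, and the condition on each
moving band compares `profile` with `c = 4E² - 6E + 2 = (2E - 1)(2E - 2)`. For fixed `θ.2` a
superlevel set of `profile` is an arc of half-length `arccos (c / t - t)`, with `t = |cos (θ.2 /
2)|`; Fubini and `t = cos β` give `quarterIntegral c`. The integration limits in the theorem are the
points where the argument of `arccos` passes `1` or `-1`.

An eigenvector at `E` forces some band to equal `E` on a set of positive measure
(`eq_zero_of_eigenvector`). Level sets of `profile` are null, so only the constant band `3/2`
remains. There the sums of `f` over all triangles vanish (`triangle_sum_eq_zero`); this is a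
closedness condition, and it gives `f` a potential `a` on the hexagon centres, with `f = ∑ a_c φ_c`
pointwise. If `f` is orthogonal to every `φ_c`, then `a` is harmonic on the triangular lattice,
hence so are its differences, which are the values of `f`; they tend to zero, so the maximum
principle gives `f = 0`. Therefore the `φ_c` span a dense subspace of the eigenspace. -/

noncomputable section

/-! ### Hermitian matrices with a split characteristic polynomial -/

namespace Matrix.IsHermitian

open Polynomial

variable {n : Type*} [Fintype n] [DecidableEq n] {A : Matrix n n ℂ}

theorem map_eigenvalues_eq (hA : A.IsHermitian) (b : n → ℝ)
    (hb : A.charpoly = ∏ i, (X - C (b i : ℂ))) :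
    Finset.univ.val.map hA.eigenvalues = Finset.univ.val.map b := by
  have h := hA.roots_charpoly_eq_eigenvalues
  rw [hb, roots_prod _ _ (Finset.prod_ne_zero_iff.2 fun i _ => X_sub_C_ne_zero _)] at h
  simp only [roots_X_sub_C, Multiset.bind_singleton] at h
  have h' := congrArg (Multiset.map Complex.re) h
  simpa [Multiset.map_map, Function.comp_def] using h'.symm

theorem trace_pow_eq_sum (hA : A.IsHermitian) (b : n → ℝ)
    (hb : A.charpoly = ∏ i, (X - C (b i : ℂ))) (k : ℕ) :
    (A ^ k).trace = ∑ i, (b i : ℂ) ^ k := by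
  have h1 : (A ^ k).trace = ∑ i, (hA.eigenvalues i : ℂ) ^ k := by
    conv_lhs => rw [hA.spectral_theorem, ← map_pow, Unitary.conjStarAlgAut_apply,
      Matrix.trace_mul_cycle, Matrix.diagonal_pow]
    simp [Matrix.trace_diagonal]
  have h2 := congrArg (fun s : Multiset ℝ => (s.map fun x : ℝ => (x : ℂ) ^ k).sum)
    (hA.map_eigenvalues_eq b hb)
  simp only [Multiset.map_map, Function.comp_def] at h2
  rw [h1]
  exact h2

/-- The rank of the Hermitian matrix `A - E` counts its nonzero eigenvalues `b i - E`, so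
rank-nullity leaves the indices with `b i = E`. -/
theorem finrank_eigenspace_toLin' (hA : A.IsHermitian) (b : n → ℝ)
    (hb : A.charpoly = ∏ i, (X - C (b i : ℂ))) (E : ℝ) :
    Module.finrank ℂ (Module.End.eigenspace (Matrix.toLin' A) (E : ℂ))
      = Nat.card {i // b i = E} := by
  have hB : (A - scalar n (E : ℂ)).IsHermitian := by
    refine hA.sub ?_
    rw [Matrix.IsHermitian]
    ext i j
    by_cases h : i = j
    · subst h; simp
    · simp [h, Ne.symm h]
  have hc : (A - scalar n (E : ℂ)).charpoly = ∏ i, (X - C ((b i - E : ℝ) : ℂ)) := by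
    rw [Matrix.charpoly_sub_scalar, hb, Polynomial.prod_comp]
    refine Finset.prod_congr rfl fun i _ => ?_
    simp
    ring
  have hker : Module.End.eigenspace (Matrix.toLin' A) (E : ℂ)
      = LinearMap.ker (A - scalar n (E : ℂ)).mulVecLin := by
    ext v
    simp [sub_eq_zero]
  have hr := LinearMap.finrank_range_add_finrank_ker (A - scalar n (E : ℂ)).mulVecLin
  rw [hker]
  have hrank : Module.finrank ℂ (LinearMap.range (A - scalar n (E : ℂ)).mulVecLin)
      = Nat.card {i // b i ≠ E} := by
    have h1 := hB.rank_eq_card_non_zero_eigs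
    rw [Matrix.rank] at h1
    rw [h1]
    have h2 := congrArg (Multiset.countP (fun x : ℝ => x ≠ 0)) (hB.map_eigenvalues_eq _ hc)
    rw [Multiset.countP_map, Multiset.countP_map] at h2
    rw [Fintype.card_subtype, Nat.card_eq_fintype_card, Fintype.card_subtype]
    simp only [ne_eq, sub_eq_zero] at h2
    exact h2
  rw [hrank, Module.finrank_fintype_fun_eq_card] at hr
  have hs := Fintype.card_subtype_compl (fun i => b i = E)
  have hle := Fintype.card_subtype_le (fun i => b i = E)
  rw [Nat.card_eq_fintype_card] at hr ⊢
  simp only [ne_eq] at hr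
  omega

end Matrix.IsHermitian

/-! ### The Bloch matrix and its characteristic polynomial -/

namespace Kagome

open Matrix

/-- The character `γ ↦ exp (i ⟨θ, γ⟩)` of `ℤ²`. -/
def character (θ : ℝ × ℝ) (γ : ℤ × ℤ) : ℂ :=
  Complex.exp (Complex.I * (θ.1 * γ.1 + θ.2 * γ.2))

theorem character_add (θ : ℝ × ℝ) (γ δ : ℤ × ℤ) :
    character θ (γ + δ) = character θ γ * character θ δ := by
  rw [character, character, character, ← Complex.exp_add]
  congr 1
  push_cast [Prod.fst_add, Prod.snd_add]
  ring

@[simp]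
theorem character_zero (θ : ℝ × ℝ) : character θ 0 = 1 := by simp [character]

theorem star_character (θ : ℝ × ℝ) (γ : ℤ × ℤ) :
    (starRingEnd ℂ) (character θ γ) = character θ (-γ) := by
  rw [character, character, ← Complex.exp_conj]
  simp
  ring_nf

theorem continuous_character (γ : ℤ × ℤ) : Continuous fun θ => character θ γ := by
  unfold character
  fun_prop

/-- The matrix of the pseudoperiodic Laplacian `Δ^θ`. -/
def bloch (θ : ℝ × ℝ) : Matrix (Fin 3) (Fin 3) ℂ :=
  !![1, -(1 + character θ (1, 0)) / 4, -(character θ (1, 0) + character θ (0, 1)) / 4;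
    -(1 + character θ (-1, 0)) / 4, 1, -(1 + character θ (0, 1)) / 4;
    -(character θ (-1, 0) + character θ (0, -1)) / 4, -(1 + character θ (0, -1)) / 4, 1]

theorem isHermitian_bloch (θ : ℝ × ℝ) : (bloch θ).IsHermitian := by
  ext i j
  fin_cases i <;> fin_cases j <;> simp [bloch, star_character]

/-- The quantity under the square roots in the band functions. -/
def dispersion (θ : ℝ × ℝ) : ℝ :=
  3 + 2 * (Real.cos θ.1 + Real.cos θ.2 + Real.cos (θ.1 - θ.2))

theorem character_mul_neg (θ : ℝ × ℝ) (γ : ℤ × ℤ) : character θ γ * character θ (-γ) = 1 := by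
  rw [← character_add]; simp

theorem dispersion_eq (θ : ℝ × ℝ) : (dispersion θ : ℂ)
    = (1 + character θ (1, 0) + character θ (0, 1))
      * (1 + character θ (-1, 0) + character θ (0, -1)) := by
  have h1 := character_mul_neg θ (1, 0)
  have h2 := character_mul_neg θ (0, 1)
  have e : ∀ γ : ℤ × ℤ, character θ γ + character θ (-γ)
      = 2 * Complex.cos (θ.1 * γ.1 + θ.2 * γ.2) := by
    intro γ
    rw [Complex.two_cos, character, character]
    congr 2
    · ring
    · push_cast [Prod.fst_neg, Prod.snd_neg]
      ring
  have e1 := e (1, 0)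
  have e2 := e (0, 1)
  have e3 := e (1, -1)
  have a1 : character θ (1, -1) = character θ (1, 0) * character θ (0, -1) := by
    rw [← character_add]; rfl
  have a2 : character θ (-1, 1) = character θ (-1, 0) * character θ (0, 1) := by
    rw [← character_add]; rfl
  simp only [Prod.neg_mk, neg_zero, neg_neg] at h1 h2 e1 e2 e3
  rw [a1, a2] at e3
  simp only [Int.cast_one, Int.cast_zero, mul_one, mul_zero, add_zero, zero_add, Int.cast_neg,
    mul_neg, ← sub_eq_add_neg] at e1 e2 e3
  rw [dispersion]
  push_cast
  linear_combination -e1 - e2 - e3 - h1 - h2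

/-- The dispersion is `|1 + x + y|²` for the two basic characters `x` and `y`. -/
theorem dispersion_nonneg (θ : ℝ × ℝ) : 0 ≤ dispersion θ := by
  have h : (dispersion θ : ℂ)
      = (Complex.normSq (1 + character θ (1, 0) + character θ (0, 1)) : ℂ) := by
    rw [← Complex.mul_conj, dispersion_eq]
    simp [star_character]
  have h' : dispersion θ = _ := Complex.ofReal_injective h
  rw [h']
  exact Complex.normSq_nonneg _

/-- With `w = z - 1` and `F = dispersion θ`, the determinant is `w³ - (F + 3) w / 16 + (F - 1) / 32
= (w - 1/2) ((w + 1/4)² - F / 16)`. The root `w = 1/2` does not depend on `θ`: it is the flat band.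
-/
theorem charpoly_bloch (θ : ℝ × ℝ) : (bloch θ).charpoly
    = ∏ k, (Polynomial.X - Polynomial.C (band k θ : ℂ)) := by
  have h1 := character_mul_neg θ (1, 0)
  have h2 := character_mul_neg θ (0, 1)
  simp only [Prod.neg_mk, neg_zero] at h1 h2
  have hF := dispersion_eq θ
  have hs : ((√(dispersion θ) : ℝ) : ℂ) ^ 2 = dispersion θ := by
    rw [← Complex.ofReal_pow, Real.sq_sqrt (dispersion_nonneg θ)]
  rw [hF] at hs
  have hb : ∀ k, (band k θ : ℂ) = (![(3 - (√(dispersion θ) : ℝ)) / 4,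
    (3 + (√(dispersion θ) : ℝ)) / 4, 3 / 2] : Fin 3 → ℂ) k := by
    intro k
    fin_cases k <;> simp [band, dispersion]
  refine Polynomial.funext fun z => ?_
  rw [Matrix.eval_charpoly, Polynomial.eval_prod, Fin.prod_univ_three]
  simp only [hb, Matrix.det_fin_three, bloch]
  simp
  generalize character θ (1, 0) = x at *
  generalize character θ (0, 1) = y at *
  generalize character θ (-1, 0) = x' at *
  generalize character θ (0, -1) = y' at *
  generalize ((√(dispersion θ) : ℝ) : ℂ) = s at *
  linear_combination ((z - 1) - 1 / 2) / 16 * hs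
    + (-(z - 1) / 8 + (2 + y + y') / 64 + ((z - 1) - 1 / 2) / 16) * h1
    + (-(z - 1) / 8 + (2 + x + x') / 64 + ((z - 1) - 1 / 2) / 16) * h2

end Kagome

namespace Kagome

open Matrix MeasureTheory

/-! ### The Laplacian in coordinates -/

theorem laplacian_graph_apply (f : Vertex → ℂ) (v : Vertex) :
    laplacian graph f v = f v - (∑ w ∈ neighbours v, f w) / 4 := by
  have h : graph.neighborFinset v = neighbours v := by
    ext w
    rw [SimpleGraph.mem_neighborFinset, adj_iff_mem_neighbours]
  rw [laplacian_apply, h, degree_eq_four]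
  push_cast
  ring

theorem laplacian_graph_zero (f : Vertex → ℂ) (m n : ℤ) :
    laplacian graph f (0, m, n)
      = f (0, m, n) - (f (1, m, n) + f (1, m + 1, n) + f (2, m + 1, n) + f (2, m, n + 1)) / 4 := by
  rw [laplacian_graph_apply, neighbours, Finset.sum_insert, Finset.sum_insert, Finset.sum_insert,
    Finset.sum_singleton]
  · ring
  all_goals simp

theorem laplacian_graph_one (f : Vertex → ℂ) (m n : ℤ) :
    laplacian graph f (1, m, n)
      = f (1, m, n) - (f (0, m, n) + f (0, m - 1, n) + f (2, m, n) + f (2, m, n + 1)) / 4 := by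
  rw [laplacian_graph_apply, neighbours, Finset.sum_insert, Finset.sum_insert, Finset.sum_insert,
    Finset.sum_singleton]
  · ring
  all_goals simp [eq_sub_iff_add_eq]

theorem laplacian_graph_two (f : Vertex → ℂ) (m n : ℤ) :
    laplacian graph f (2, m, n)
      = f (2, m, n) - (f (0, m - 1, n) + f (0, m, n - 1) + f (1, m, n) + f (1, m, n - 1)) / 4 := by
  rw [laplacian_graph_apply, neighbours, Finset.sum_insert, Finset.sum_insert, Finset.sum_insert,
    Finset.sum_singleton]
  · ring
  all_goals simp [eq_sub_iff_add_eq]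

/-! ### Pseudoperiodic functions -/

/-- The `θ`-pseudoperiodic function with the values `u` in the fundamental cell. -/
def extend (θ : ℝ × ℝ) : (Fin 3 → ℂ) →ₗ[ℂ] (Vertex → ℂ) where
  toFun u v := character θ v.2 * u v.1
  map_add' u w := by ext v; simp [mul_add]
  map_smul' c u := by ext v; simp [mul_left_comm]

theorem extend_apply (θ : ℝ × ℝ) (u : Fin 3 → ℂ) (v : Vertex) :
    extend θ u v = character θ v.2 * u v.1 := rfl

theorem laplacian_extend (θ : ℝ × ℝ) (u : Fin 3 → ℂ) :
    laplacian graph (extend θ u) = extend θ (bloch θ *ᵥ u) := by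
  have e : ∀ m n a b : ℤ, character θ (m + a, n + b) = character θ (m, n) * character θ (a, b) :=
    fun m n a b => character_add θ (m, n) (a, b)
  have e1 := fun m n => e m n 1 0
  have e2 := fun m n => e m n 0 1
  have e3 := fun m n => e m n (-1) 0
  have e4 := fun m n => e m n 0 (-1)
  simp only [add_zero] at e1 e2 e3 e4
  ext ⟨s, m, n⟩
  fin_cases s
  · simp only [Fin.zero_eta, laplacian_graph_zero, extend_apply, e1, e2, bloch]
    simp [Matrix.mulVec, dotProduct, Fin.sum_univ_three]
    ring
  · simp only [Fin.mk_one, laplacian_graph_one, extend_apply, sub_eq_add_neg, e2, e3, bloch]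
    simp [Matrix.mulVec, dotProduct, Fin.sum_univ_three]
    ring
  · simp only [Fin.reduceFinMk, laplacian_graph_two, extend_apply, sub_eq_add_neg, e3, e4, bloch]
    simp [Matrix.mulVec, dotProduct, Fin.sum_univ_three]
    ring

theorem extend_injective (θ : ℝ × ℝ) : Function.Injective (extend θ) := by
  intro u w h
  ext s
  simpa [extend_apply] using congrFun h (s, 0)

theorem range_extend (θ : ℝ × ℝ) : LinearMap.range (extend θ) = quasiperiodic θ := by
  ext f
  constructor
  · rintro ⟨u, rfl⟩ γ ⟨s, δ⟩
    change character θ (δ + γ) * u s = character θ γ * (character θ δ * u s)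
    rw [character_add]
    ring
  · intro hf
    refine ⟨fun s => f (s, 0), ?_⟩
    ext ⟨s, γ⟩
    have h := hf γ (s, 0)
    rw [translate, zero_add] at h
    exact h.symm

/-- `extend θ` is injective with range `quasiperiodic θ` and intertwines `bloch θ` with the
Laplacian, so it identifies the eigenspaces. -/
theorem finrank_floquetEigenspace (θ : ℝ × ℝ) (E : ℝ) :
    Module.finrank ℂ (floquetEigenspace θ E) = Nat.card {k : Fin 3 // band k θ = E} := by
  rw [← (isHermitian_bloch θ).finrank_eigenspace_toLin' _ (charpoly_bloch θ) E]
  have h : floquetEigenspace θ E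
      = (Module.End.eigenspace (Matrix.toLin' (bloch θ)) (E : ℂ)).map (extend θ) := by
    ext f
    rw [floquetEigenspace, Submodule.mem_inf, ← range_extend, Submodule.mem_map]
    constructor
    · rintro ⟨⟨u, rfl⟩, h⟩
      refine ⟨u, ?_, rfl⟩
      rw [Module.End.mem_eigenspace_iff] at h ⊢
      rw [laplacian_extend, ← map_smul] at h
      exact extend_injective θ h
    · rintro ⟨u, hu, rfl⟩
      refine ⟨⟨u, rfl⟩, ?_⟩
      rw [Module.End.mem_eigenspace_iff] at hu ⊢
      rw [laplacian_extend, ← map_smul, ← hu]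
      rfl
  rw [h]
  exact (LinearEquiv.finrank_eq
    (Submodule.equivMapOfInjective _ (extend_injective θ) _)).symm

/-! ### The moments of the density of states -/

/-- The fundamental domain `[0, 2π)²` of the dual lattice. -/
def brillouin : Set (ℝ × ℝ) := Set.Ico 0 (2 * Real.pi) ×ˢ Set.Ico 0 (2 * Real.pi)

theorem measurableSet_brillouin : MeasurableSet brillouin :=
  measurableSet_Ico.prod measurableSet_Ico

theorem volume_brillouin : volume brillouin = ENNReal.ofReal ((2 * Real.pi) ^ 2) := by
  rw [brillouin, Measure.volume_eq_prod, Measure.prod_prod, Real.volume_Ico, sub_zero, sq,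
    ENNReal.ofReal_mul Real.two_pi_pos.le]

theorem integrableOn_brillouin {f : ℝ × ℝ → ℂ} (hf : Continuous f) :
    IntegrableOn f brillouin :=
  (hf.continuousOn.integrableOn_compact (isCompact_Icc.prod isCompact_Icc)).mono_set
    (Set.prod_mono Set.Ico_subset_Icc_self Set.Ico_subset_Icc_self)

theorem integral_exp_int (n : ℤ) :
    ∫ x in Set.Ico 0 (2 * Real.pi), Complex.exp (Complex.I * (x * n))
      = if n = 0 then (2 * Real.pi : ℂ) else 0 := by
  rw [integral_Ico_eq_integral_Ioc, ← intervalIntegral.integral_of_le Real.two_pi_pos.le]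
  split_ifs with h
  · simp [h]
  · have hc : Complex.I * n ≠ 0 := mul_ne_zero Complex.I_ne_zero (by exact_mod_cast h)
    have e : ∀ x : ℝ, Complex.exp (Complex.I * (x * n)) = Complex.exp (Complex.I * n * x) := by
      intro x; congr 1; ring
    simp only [e]
    rw [integral_exp_mul_complex hc, div_eq_zero_iff]
    left
    have : Complex.I * n * ((2 * Real.pi : ℝ) : ℂ) = n * (2 * Real.pi * Complex.I) := by
      push_cast; ring
    rw [this, Complex.exp_int_mul_two_pi_mul_I]
    simp

theorem integral_character (γ : ℤ × ℤ) :
    ∫ θ in brillouin, character θ γ = if γ = 0 then (2 * Real.pi : ℂ) ^ 2 else 0 := by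
  have h := setIntegral_prod_mul (μ := (volume : Measure ℝ)) (ν := (volume : Measure ℝ))
    (fun x : ℝ => Complex.exp (Complex.I * (x * γ.1)))
    (fun x : ℝ => Complex.exp (Complex.I * (x * γ.2)))
    (Set.Ico 0 (2 * Real.pi)) (Set.Ico 0 (2 * Real.pi))
  rw [integral_exp_int, integral_exp_int, ← Measure.volume_eq_prod] at h
  have e : ∀ θ : ℝ × ℝ, character θ γ
      = Complex.exp (Complex.I * (θ.1 * γ.1)) * Complex.exp (Complex.I * (θ.2 * γ.2)) := by
    intro θ
    rw [character, ← Complex.exp_add]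
    congr 1
    ring
  simp only [e]
  rw [brillouin, h]
  obtain ⟨a, b⟩ := γ
  by_cases ha : a = 0 <;> by_cases hb : b = 0 <;> simp [ha, hb, sq]

theorem continuous_bloch : Continuous bloch := by
  refine continuous_pi fun i => continuous_pi fun j => ?_
  have := continuous_character
  fin_cases i <;> fin_cases j <;> simp [bloch] <;> fun_prop

theorem laplacian_integral {w : ℝ × ℝ → Fin 3 → ℂ} (hw : Continuous w) :
    laplacian graph (fun v => ∫ θ in brillouin, extend θ (w θ) v)
      = fun v => ∫ θ in brillouin, extend θ (bloch θ *ᵥ w θ) v := by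
  have hi : ∀ v, IntegrableOn (fun θ => extend θ (w θ) v) brillouin := fun v =>
    integrableOn_brillouin ((continuous_character v.2).mul ((continuous_apply v.1).comp hw))
  ext v
  simp only [← laplacian_extend, laplacian_graph_apply]
  rw [integral_sub (hi v) ((integrable_finsetSum _ fun u _ => hi u).div_const 4),
    integral_div, integral_finsetSum _ fun u _ => hi u]

theorem Δ_coe (f : ℓ²(Vertex, ℂ)) : (Δ f : Vertex → ℂ) = laplacian graph f := rfl

/-- By orthogonality of characters, `δ_v` is the torus average of the quasiperiodic functions with
cell values `character θ (-v.2)` times a basis vector. The Laplacian is a finite sum, hence commutes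
with the average and multiplies each fibre by `bloch θ`. -/
theorem Δ_pow_single (n : ℕ) (v u : Vertex) :
    (((Δ ^ n) (lp.single 2 v (1 : ℂ)) : ℓ²(Vertex, ℂ)) : Vertex → ℂ) u
      = (2 * Real.pi : ℂ)⁻¹ ^ 2
        * ∫ θ in brillouin, character θ (u.2 - v.2) * (bloch θ ^ n) u.1 v.1 := by
  have key : ((Δ ^ n) (lp.single 2 v (1 : ℂ)) : Vertex → ℂ)
      = (2 * Real.pi : ℂ)⁻¹ ^ 2 • fun u => ∫ θ in brillouin,
        extend θ (fun s => character θ (-v.2) * (bloch θ ^ n) s v.1) u := by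
    induction n with
    | zero =>
      ext u
      simp only [pow_zero, one_apply_eq_self, lp.coeFn_single, Pi.smul_apply,
        extend_apply, ← mul_assoc, ← character_add]
      rw [integral_mul_const, integral_character]
      obtain ⟨s, γ⟩ := u
      obtain ⟨t, δ⟩ := v
      have hp : (Real.pi : ℂ) ≠ 0 := by exact_mod_cast Real.pi_ne_zero
      simp only [Pi.single_apply, Prod.mk.injEq, Matrix.one_apply, ← sub_eq_add_neg, sub_eq_zero]
      by_cases h1 : s = t <;> by_cases h2 : γ = δ <;> simp [h1, h2]
      field_simp
    | succ n ih =>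
      have hw : Continuous fun θ => (fun s => character θ (-v.2) * (bloch θ ^ n) s v.1 :
          Fin 3 → ℂ) := by
        refine continuous_pi fun s => (continuous_character _).mul ?_
        have h := continuous_bloch.pow n
        exact (continuous_apply _).comp ((continuous_apply _).comp h)
      rw [pow_succ', mul_apply_eq_comp, Δ_coe, ih, map_smul, laplacian_integral hw]
      congr 1
      ext u
      refine integral_congr_ae (Filter.Eventually.of_forall fun θ => ?_)
      refine congrFun (congrArg _ (funext fun s => ?_)) u
      simp only [pow_succ', Matrix.mulVec, dotProduct, Matrix.mul_apply, Finset.mul_sum]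
      exact Finset.sum_congr rfl fun t _ => by ring
  rw [key, Pi.smul_apply, smul_eq_mul]
  congr 2
  ext θ
  rw [extend_apply, sub_eq_add_neg, character_add]
  ring

theorem inner_single_Δ_pow (n : ℕ) (v : Vertex) :
    inner ℂ (lp.single 2 v (1 : ℂ) : ℓ²(Vertex, ℂ)) ((Δ ^ n) (lp.single 2 v (1 : ℂ)))
      = (2 * Real.pi : ℂ)⁻¹ ^ 2 * ∫ θ in brillouin, (bloch θ ^ n) v.1 v.1 := by
  rw [lp.inner_single_left, Δ_pow_single]
  simp

/-- A fundamental domain has exactly one vertex of each of the three types. Sums of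
translation-invariant quantities over `Q` therefore do not depend on `Q`. -/
theorem exists_of_isFundamentalDomain {Q : Finset Vertex} (hQ : IsFundamentalDomain Q) :
    ∃ γ : Fin 3 → ℤ × ℤ, Q = Finset.univ.image fun s => (s, γ s) := by
  choose γ h1 h2 using fun s => hQ (s, 0)
  refine ⟨γ, ?_⟩
  ext ⟨s, δ⟩
  simp only [Finset.mem_image, Finset.mem_univ, true_and, Prod.mk.injEq]
  constructor
  · intro h
    exact ⟨s, rfl, (h2 s δ (by simpa [translate] using h)).symm⟩
  · rintro ⟨t, rfl, rfl⟩
    simpa [translate] using h1 t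

theorem sum_isFundamentalDomain {M : Type*} [AddCommMonoid M] {Q : Finset Vertex}
    (hQ : IsFundamentalDomain Q) (f : Fin 3 → M) : ∑ v ∈ Q, f v.1 = ∑ s, f s := by
  obtain ⟨γ, rfl⟩ := exists_of_isFundamentalDomain hQ
  rw [Finset.sum_image]
  intro s _ t _ h
  exact congrArg Prod.fst h

theorem sum_inner_single_Δ_pow {Q : Finset Vertex} (hQ : IsFundamentalDomain Q) (n : ℕ) :
    ∑ v ∈ Q, inner ℂ (lp.single 2 v (1 : ℂ) : ℓ²(Vertex, ℂ)) ((Δ ^ n) (lp.single 2 v (1 : ℂ)))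
      = (((2 * Real.pi)⁻¹ ^ 2 * ∫ θ in brillouin, ∑ k, band k θ ^ n : ℝ) : ℂ) := by
  simp only [inner_single_Δ_pow]
  rw [sum_isFundamentalDomain hQ
    (fun s => (2 * Real.pi : ℂ)⁻¹ ^ 2 * ∫ θ in brillouin, (bloch θ ^ n) s s), ← Finset.mul_sum,
    ← integral_finsetSum]
  · push_cast
    rw [← integral_complex_ofReal]
    congr 2
    ext θ
    have h := (isHermitian_bloch θ).trace_pow_eq_sum _ (charpoly_bloch θ) n
    rw [Matrix.trace] at h
    push_cast
    exact h
  · intro s _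
    refine integrableOn_brillouin ?_
    exact (continuous_apply _).comp ((continuous_apply _).comp (continuous_bloch.pow n))

end Kagome

namespace Kagome

open Filter Topology Polynomial

/-! ### Functional calculus of a bounded self-adjoint operator -/

section Operator

variable {H : Type*} [NormedAddCommGroup H] [InnerProductSpace ℂ H] {A : H →L[ℂ] H}

/-- The value of a real polynomial at an operator. -/
def polynomialOf (p : ℝ[X]) (A : H →L[ℂ] H) : H →L[ℂ] H := aeval A p

theorem polynomialOf_add (p q : ℝ[X]) (A : H →L[ℂ] H) :
    polynomialOf (p + q) A = polynomialOf p A + polynomialOf q A := map_add _ _ _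

theorem polynomialOf_monomial (n : ℕ) (a : ℝ) (A : H →L[ℂ] H) :
    polynomialOf (monomial n a) A = (a : ℂ) • A ^ n := by
  rw [polynomialOf, aeval_monomial, Complex.coe_smul, Algebra.smul_def]

theorem polynomialOf_apply_eigenvector {E : ℝ} {f : H} (hf : A f = (E : ℂ) • f) (p : ℝ[X]) :
    polynomialOf p A f = ((p.eval E : ℝ) : ℂ) • f := by
  induction p using Polynomial.induction_on' with
  | add p q hp hq => simp [polynomialOf_add, hp, hq, add_smul]
  | monomial n a =>
    have h : (A ^ n) f = ((E : ℂ) ^ n) • f := by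
      induction n with
      | zero => simp
      | succ n ih => rw [pow_succ', mul_apply_eq_comp, ih, map_smul, hf, smul_smul, pow_succ]
    rw [polynomialOf_monomial, eval_monomial, _root_.smul_apply, h, smul_smul]
    push_cast
    rfl

variable [CompleteSpace H]

/-- The continuous functional calculus `g(A)`. -/
def functionOf (g : ℝ → ℝ) (A : H →L[ℂ] H) : H →L[ℂ] H := cfc g A

theorem isSelfAdjoint_functionOf (g : ℝ → ℝ) (A : H →L[ℂ] H) : IsSelfAdjoint (functionOf g A) :=
  cfc_predicate g A

theorem inner_functionOf_mul_self {g : ℝ → ℝ} (hg : Continuous g) (A : H →L[ℂ] H) (x : H) :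
    inner ℂ x (functionOf (fun t => g t * g t) A x) = ((‖functionOf g A x‖ ^ 2 : ℝ) : ℂ) := by
  rw [functionOf, cfc_mul g g A hg.continuousOn hg.continuousOn, mul_apply_eq_comp,
    ← functionOf, ← ContinuousLinearMap.adjoint_inner_left,
    ContinuousLinearMap.isSelfAdjoint_iff'.1 (isSelfAdjoint_functionOf g A),
    inner_self_eq_norm_sq_to_K]
  push_cast
  rfl

theorem exists_spectrum_subset_Icc (A : H →L[ℂ] H) (r : ℝ) :
    ∃ R, r ≤ R ∧ spectrum ℝ A ⊆ Set.Icc (-R) R := by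
  refine ⟨max r (‖A‖ * ‖(1 : H →L[ℂ] H)‖), le_max_left _ _, fun x hx => ?_⟩
  have h := spectrum.norm_le_norm_mul_of_mem hx
  exact abs_le.1 (h.trans (le_max_right _ _))

/-- One polynomial has to be close to `g` both on the spectrum and on `[-r, r]`. The second set is
chosen to contain an eigenvalue or the ranges of the bands, so that these need not be located in the
spectrum. -/
theorem exists_polynomial_near_on_spectrum (A : H →L[ℂ] H) (r : ℝ) {g : ℝ → ℝ}
    (hg : Continuous g) {ε : ℝ} (hε : 0 < ε) :
    ∃ p : ℝ[X], (∀ x ∈ spectrum ℝ A, |g x - p.eval x| ≤ ε) ∧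
      ∀ x, |x| ≤ r → |g x - p.eval x| ≤ ε := by
  obtain ⟨R, hr, hR⟩ := exists_spectrum_subset_Icc A r
  obtain ⟨p, hp⟩ := exists_polynomial_near_of_continuousOn (-R) R g hg.continuousOn ε hε
  refine ⟨p, fun x hx => ?_, fun x hx => ?_⟩
  · rw [abs_sub_comm]
    exact (hp x (hR hx)).le
  · rw [abs_sub_comm]
    exact (hp x (abs_le.1 (hx.trans hr))).le

theorem norm_functionOf_sub_polynomialOf_le (hA : IsSelfAdjoint A) {g : ℝ → ℝ}
    (hg : Continuous g) {p : ℝ[X]} {ε : ℝ} (hε : 0 ≤ ε) (h : ∀ x ∈ spectrum ℝ A, |g x - p.eval x| ≤ ε) :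
    ‖functionOf g A - polynomialOf p A‖ ≤ ε := by
  rw [functionOf, polynomialOf, ← cfc_polynomial p A hA, ← cfc_sub g p.eval A hg.continuousOn
    p.continuous.continuousOn]
  exact norm_cfc_le hε h

theorem functionOf_apply_eigenvector (hA : IsSelfAdjoint A) {E : ℝ} {f : H}
    (hf : A f = (E : ℂ) • f) {g : ℝ → ℝ} (hg : Continuous g) :
    functionOf g A f = ((g E : ℝ) : ℂ) • f := by
  rw [← sub_eq_zero, ← norm_le_zero_iff]
  refine le_of_forall_pos_le_add fun δ hδ => ?_
  -- Two approximation errors, each at most `δ / 2` after multiplication by `‖f‖`; the `+ 1` keeps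
  -- the denominator positive.
  have hc : 0 < 2 * (‖f‖ + 1) := by positivity
  obtain ⟨p, hp1, hp2⟩ := exists_polynomial_near_on_spectrum A |E| hg (div_pos hδ hc)
  have h1 := norm_functionOf_sub_polynomialOf_le hA hg (div_pos hδ hc).le hp1
  have h2 := hp2 E le_rfl
  have e : functionOf g A f - ((g E : ℝ) : ℂ) • f
      = (functionOf g A - polynomialOf p A) f + ((p.eval E - g E : ℝ) : ℂ) • f := by
    rw [sub_apply, polynomialOf_apply_eigenvector hf]
    push_cast
    rw [sub_smul]
    abel
  rw [e, zero_add]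
  refine (norm_add_le _ _).trans ?_
  have h3 := ContinuousLinearMap.le_of_opNorm_le _ h1 f
  rw [norm_smul, Complex.norm_real, Real.norm_eq_abs, abs_sub_comm]
  have h4 := mul_le_mul_of_nonneg_right h2 (norm_nonneg f)
  have h5 : δ / (2 * (‖f‖ + 1)) * ‖f‖ ≤ δ / 2 := by
    rw [div_mul_eq_mul_div, div_le_div_iff₀ hc two_pos]
    nlinarith [norm_nonneg f]
  linarith

theorem IsSelfAdjoint.eigenvalue_im_eq_zero (hA : IsSelfAdjoint A) {E : ℂ} {f : H} (hf0 : f ≠ 0)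
    (hf : A f = E • f) : E.im = 0 := by
  have h := hA.isSymmetric.conj_eigenvalue_eq_self
    (Module.End.hasEigenvalue_of_hasEigenvector ⟨Module.End.mem_eigenspace_iff.2 hf, hf0⟩)
  exact Complex.conj_eq_iff_im.1 h

/-- Continuous functions decreasing to the indicator function of `(-∞, E]`. -/
def ramp (E : ℝ) (n : ℕ) (x : ℝ) : ℝ := max 0 (1 - n * max (x - E) 0)

theorem continuous_ramp (E : ℝ) (n : ℕ) : Continuous (ramp E n) := by
  unfold ramp
  fun_prop

theorem abs_ramp_le_one (E : ℝ) (n : ℕ) (x : ℝ) : |ramp E n x| ≤ 1 := by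
  rw [ramp, abs_of_nonneg (le_max_left _ _), max_le_iff]
  have : 0 ≤ n * max (x - E) 0 := by positivity
  exact ⟨zero_le_one, by linarith⟩

theorem tendsto_ramp (E x : ℝ) :
    Tendsto (fun n => ramp E n x) atTop (𝓝 (Set.indicator (Set.Iic E) 1 x)) := by
  by_cases h : x ≤ E
  · rw [Set.indicator_of_mem (Set.mem_Iic.2 h)]
    have : ∀ n, ramp E n x = 1 := fun n => by simp [ramp, max_eq_right (sub_nonpos.2 h)]
    simp [this]
  · rw [Set.indicator_of_notMem (by simpa using h)]
    rw [not_le] at h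
    have hp : 0 < x - E := sub_pos.2 h
    obtain ⟨N, hN⟩ := exists_nat_gt (1 / (x - E))
    refine tendsto_const_nhds.congr' (eventually_atTop.2 ⟨N, fun n hn => ?_⟩)
    have h1 : 1 / (x - E) < n := hN.trans_le (by exact_mod_cast hn)
    rw [div_lt_iff₀ hp] at h1
    change 0 = ramp E n x
    rw [ramp, max_eq_left hp.le, max_eq_left (by linarith)]

/-- The ramp vanishes once `x - E` reaches `1 / (n + 1)`. -/
theorem abs_ramp_mul_le (E : ℝ) (n : ℕ) (x : ℝ) :
    |ramp E (n + 1) x * max (x - E) 0| ≤ 1 / ((n : ℝ) + 1) := by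
  have hm : 0 ≤ max (x - E) 0 := le_max_right _ _
  have hr : 0 ≤ ramp E (n + 1) x := le_max_left _ _
  rw [abs_of_nonneg (mul_nonneg hr hm), ramp, le_div_iff₀ (by positivity)]
  push_cast
  generalize max (x - E) 0 = m at *
  have hu : 0 ≤ ((n : ℝ) + 1) * m := by positivity
  rcases max_cases 0 (1 - ((n : ℝ) + 1) * m) with ⟨h, _⟩ | ⟨h, _⟩ <;> rw [h]
  · simp
  · nlinarith [sq_nonneg (((n : ℝ) + 1) * m - 1)]

/-- The ramp is `1 + k(x) (x - E)₊` with `k` continuous, so it acts as the identity on the kernel of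
`(A - E)₊`. -/
theorem cfc_ramp_apply_of_mem_ker (hA : IsSelfAdjoint A) (E : ℝ) (n : ℕ) {x : H}
    (hx : cfc (fun x : ℝ => max (x - E) 0) A x = 0) : cfc (ramp E n) A x = x := by
  have hk : ∃ k : ℝ → ℝ, Continuous k ∧ ∀ x, ramp E n x = 1 + k x * max (x - E) 0 := by
    rcases Nat.eq_zero_or_pos n with rfl | hn
    · exact ⟨fun _ => 0, continuous_const, fun x => by simp [ramp]⟩
    · have hn' : (0 : ℝ) < n := by exact_mod_cast hn
      -- This `k` is `-n` on the sloping part and to its left, and `-1 / (x - E)₊` beyond it; the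
      -- maximum keeps the denominator away from zero.
      refine ⟨fun x => -(1 / max (max (x - E) 0) (1 / (n : ℝ))),
        (continuous_const.div (by fun_prop) fun x =>
          (lt_max_of_lt_right (by positivity)).ne').neg, fun x => ?_⟩
      have hm : 0 ≤ max (x - E) 0 := le_max_right _ _
      change max 0 (1 - n * max (x - E) 0)
        = 1 + -(1 / max (max (x - E) 0) (1 / (n : ℝ))) * max (x - E) 0
      generalize max (x - E) 0 = m at *
      rcases le_total m (1 / (n : ℝ)) with h | h
      · rw [max_eq_right h, max_eq_right]
        · field_simp
          ring
        · rw [le_div_iff₀ hn'] at h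
          linarith
      · have hmpos : 0 < m := lt_of_lt_of_le (by positivity) h
        rw [max_eq_left h, max_eq_left]
        · field_simp
          ring
        · rw [div_le_iff₀ hn'] at h
          linarith
  obtain ⟨k, hkc, hk⟩ := hk
  have e : cfc (ramp E n) A = 1 + cfc k A * cfc (fun x : ℝ => max (x - E) 0) A := by
    rw [← cfc_mul k _ A hkc.continuousOn (by fun_prop), ← cfc_const_one ℝ A hA,
      ← cfc_add A (fun _ => 1) _ (by fun_prop) (by fun_prop)]
    exact congrArg (cfc · A) (funext hk)
  rw [e, add_apply, mul_apply_eq_comp, hx, map_zero, add_zero, one_apply_eq_self]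

/-- On the range of `(A - E)₊` the ramps are `O(1/n)` by `abs_ramp_mul_le`; being contractions, they
also tend to zero on its closure. -/
theorem tendsto_cfc_ramp_of_mem_closure (E : ℝ) {y : H}
    (hy : y ∈ closure (Set.range (cfc (fun x : ℝ => max (x - E) 0) A : H →L[ℂ] H))) :
    Tendsto (fun n => cfc (ramp E n) A y) atTop (𝓝 0) := by
  rw [Metric.tendsto_atTop]
  intro ε hε
  obtain ⟨_, ⟨z, rfl⟩, hz⟩ := Metric.mem_closure_iff.1 hy (ε / 2) (half_pos hε)
  set B := cfc (fun x : ℝ => max (x - E) 0) A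
  obtain ⟨N, hN⟩ := exists_nat_gt (2 * (‖z‖ + 1) / ε)
  refine ⟨N + 1, fun n hn => ?_⟩
  obtain ⟨m, rfl⟩ : ∃ m, n = m + 1 := ⟨n - 1, by omega⟩
  have h1 : ‖cfc (ramp E (m + 1)) A‖ ≤ 1 :=
    norm_cfc_le zero_le_one fun x _ => abs_ramp_le_one E _ x
  have h2 : ‖cfc (ramp E (m + 1)) A * B‖ ≤ 1 / ((m : ℝ) + 1) := by
    rw [← cfc_mul _ _ A (continuous_ramp E _).continuousOn (by fun_prop)]
    exact norm_cfc_le (by positivity) fun x _ => abs_ramp_mul_le E m x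
  have e : cfc (ramp E (m + 1)) A y
      = cfc (ramp E (m + 1)) A (y - B z) + (cfc (ramp E (m + 1)) A * B) z := by
    rw [mul_apply_eq_comp, map_sub]
    abel
  rw [dist_zero_right, e]
  refine (norm_add_le _ _).trans_lt ?_
  have h3 := ContinuousLinearMap.le_of_opNorm_le _ h1 (y - B z)
  have h4 := ContinuousLinearMap.le_of_opNorm_le _ h2 z
  rw [dist_eq_norm] at hz
  have h5 : 1 / ((m : ℝ) + 1) * ‖z‖ < ε / 2 := by
    have hm : (N : ℝ) ≤ m := by exact_mod_cast Nat.le_of_succ_le_succ hn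
    rw [div_lt_iff₀ hε] at hN
    rw [div_mul_eq_mul_div, div_lt_div_iff₀ (by positivity) two_pos]
    nlinarith [norm_nonneg z]
  linarith

/-- For the self-adjoint `B = (A - E)₊`, the orthogonal complement of the kernel is the closure of
the range. The ramps fix the kernel component of `x` and send the other one to zero. -/
theorem tendsto_functionOf_ramp (hA : IsSelfAdjoint A) (E : ℝ) (x : H) :
    Tendsto (fun n => functionOf (ramp E n) A x) atTop (𝓝 (spectralProjector A E x)) := by
  set B := cfc (fun x : ℝ => max (x - E) 0) A with hBdef
  have hB : IsSelfAdjoint B := cfc_predicate _ A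
  have h1 : spectralProjector A E x ∈ B.ker := Submodule.starProjection_apply_mem _ _
  have h2 : x - spectralProjector A E x ∈ B.kerᗮ := Submodule.sub_starProjection_mem_orthogonal x
  rw [ContinuousLinearMap.orthogonal_ker, ContinuousLinearMap.isSelfAdjoint_iff'.1 hB] at h2
  have h3 := tendsto_cfc_ramp_of_mem_closure E (y := x - spectralProjector A E x) h2
  have h4 := h3.add_const (spectralProjector A E x)
  rw [zero_add] at h4
  refine h4.congr fun n => ?_
  have h5 := cfc_ramp_apply_of_mem_ker hA E n (LinearMap.mem_ker.1 h1)
  rw [functionOf, map_sub, h5, sub_add_cancel]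

end Operator

end Kagome

namespace Kagome

open Filter Topology Polynomial MeasureTheory

/-! ### The density of states measure -/

theorem continuous_band (k : Fin 3) : Continuous (band k) := by
  have h : Continuous fun θ : ℝ × ℝ =>
      √(3 + 2 * (Real.cos θ.1 + Real.cos θ.2 + Real.cos (θ.1 - θ.2))) := by fun_prop
  fin_cases k
  · exact (continuous_const.sub h).div_const 4
  · exact (continuous_const.add h).div_const 4
  · exact continuous_const

theorem dispersion_le (θ : ℝ × ℝ) : dispersion θ ≤ 9 := by
  have h1 := Real.cos_le_one θ.1
  have h2 := Real.cos_le_one θ.2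
  have h3 := Real.cos_le_one (θ.1 - θ.2)
  rw [dispersion]
  linarith

theorem sqrt_dispersion_le (θ : ℝ × ℝ) : √(dispersion θ) ≤ 3 :=
  Real.sqrt_le_iff.2 ⟨by norm_num, (dispersion_le θ).trans (by norm_num)⟩

theorem band_zero (θ : ℝ × ℝ) : band 0 θ = (3 - √(dispersion θ)) / 4 := rfl

theorem band_one (θ : ℝ × ℝ) : band 1 θ = (3 + √(dispersion θ)) / 4 := rfl

theorem band_two (θ : ℝ × ℝ) : band 2 θ = 3 / 2 := rfl

theorem band_mem_Icc (k : Fin 3) (θ : ℝ × ℝ) : band k θ ∈ Set.Icc 0 (3 / 2) := by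
  have h1 := Real.sqrt_nonneg (dispersion θ)
  have h2 := sqrt_dispersion_le θ
  fin_cases k
  · rw [Fin.zero_eta, band_zero]; constructor <;> linarith
  · rw [Fin.mk_one, band_one]; constructor <;> linarith
  · change band 2 θ ∈ _
    rw [band_two]; norm_num

/-- The integral of a function against the density of states, in terms of the bands. -/
def bandIntegral (g : ℝ → ℝ) : ℝ := (2 * Real.pi)⁻¹ ^ 2 * ∫ θ in brillouin, ∑ k, g (band k θ)

theorem isFiniteMeasure_brillouin : IsFiniteMeasure (volume.restrict brillouin) :=
  ⟨by rw [Measure.restrict_apply_univ, volume_brillouin]; exact ENNReal.ofReal_lt_top⟩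

theorem volume_real_brillouin : volume.real brillouin = (2 * Real.pi) ^ 2 := by
  rw [Measure.real, volume_brillouin, ENNReal.toReal_ofReal (by positivity)]

theorem integrableOn_sum_band {g : ℝ → ℝ} (hg : Continuous g) :
    IntegrableOn (fun θ => ∑ k, g (band k θ)) brillouin := by
  have hc : Continuous fun θ => ∑ k, g (band k θ) :=
    continuous_finsetSum _ fun k _ => hg.comp (continuous_band k)
  exact (hc.continuousOn.integrableOn_compact (isCompact_Icc.prod isCompact_Icc)).mono_set
    (Set.prod_mono Set.Ico_subset_Icc_self Set.Ico_subset_Icc_self)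

theorem abs_bandIntegral_sub_le {g h : ℝ → ℝ} (hg : Continuous g) (hh : Continuous h) {ε : ℝ}
    (hgh : ∀ x ∈ Set.Icc (0 : ℝ) (3 / 2), |g x - h x| ≤ ε) :
    |bandIntegral g - bandIntegral h| ≤ 3 * ε := by
  rw [bandIntegral, bandIntegral, ← mul_sub,
    ← integral_sub (integrableOn_sum_band hg) (integrableOn_sum_band hh), abs_mul,
    abs_of_nonneg (by positivity)]
  have h1 : ‖∫ θ in brillouin, (∑ k, g (band k θ) - ∑ k, h (band k θ))‖
      ≤ 3 * ε * volume.real brillouin := by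
    refine norm_setIntegral_le_of_norm_le_const
      (by rw [volume_brillouin]; exact ENNReal.ofReal_lt_top) fun θ _ => ?_
    rw [← Finset.sum_sub_distrib]
    refine (norm_sum_le_of_le _ fun k _ => hgh _ (band_mem_Icc k θ)).trans ?_
    simp
  rw [volume_real_brillouin] at h1
  refine (mul_le_mul_of_nonneg_left h1 (by positivity)).trans_eq ?_
  have := Real.pi_ne_zero
  field_simp

/-- `Tr (χ_Q B)`. -/
def cellTrace (Q : Finset Vertex) (B : ℓ²(Vertex, ℂ) →L[ℂ] ℓ²(Vertex, ℂ)) : ℂ :=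
  ∑ v ∈ Q, inner ℂ (lp.single 2 v (1 : ℂ) : ℓ²(Vertex, ℂ)) (B (lp.single 2 v (1 : ℂ)))

theorem card_of_isFundamentalDomain {Q : Finset Vertex} (hQ : IsFundamentalDomain Q) :
    Q.card = 3 := by
  rw [Finset.card_eq_sum_ones, sum_isFundamentalDomain hQ (fun _ => 1)]
  simp

theorem norm_single_one (v : Vertex) : ‖(lp.single 2 v (1 : ℂ) : ℓ²(Vertex, ℂ))‖ = 1 := by
  rw [lp.norm_single (by norm_num)]
  simp

theorem cellTrace_sub (Q : Finset Vertex) (B C : ℓ²(Vertex, ℂ) →L[ℂ] ℓ²(Vertex, ℂ)) :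
    cellTrace Q (B - C) = cellTrace Q B - cellTrace Q C := by
  simp only [cellTrace, sub_apply, inner_sub_right, Finset.sum_sub_distrib]

theorem norm_cellTrace_le {Q : Finset Vertex} (hQ : IsFundamentalDomain Q)
    (B : ℓ²(Vertex, ℂ) →L[ℂ] ℓ²(Vertex, ℂ)) : ‖cellTrace Q B‖ ≤ 3 * ‖B‖ := by
  refine (norm_sum_le_of_le (f := fun v => inner ℂ (lp.single 2 v (1 : ℂ) : ℓ²(Vertex, ℂ))
    (B (lp.single 2 v (1 : ℂ)))) Q (n := fun _ => ‖B‖) fun v _ => ?_).trans ?_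
  · refine (norm_inner_le_norm _ _).trans ?_
    have h := B.le_opNorm (lp.single 2 v (1 : ℂ))
    rw [norm_single_one, mul_one] at h
    rwa [norm_single_one, one_mul]
  · rw [Finset.sum_const, card_of_isFundamentalDomain hQ]
    simp

theorem cellTrace_polynomialOf {Q : Finset Vertex} (hQ : IsFundamentalDomain Q) (p : ℝ[X]) :
    cellTrace Q (polynomialOf p Δ) = (bandIntegral p.eval : ℂ) := by
  induction p using Polynomial.induction_on' with
  | add p q hp hq =>
    have h : bandIntegral (p + q).eval = bandIntegral p.eval + bandIntegral q.eval := by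
      rw [bandIntegral, bandIntegral, bandIntegral, ← mul_add, ← integral_add
        (integrableOn_sum_band p.continuous) (integrableOn_sum_band q.continuous)]
      simp [Finset.sum_add_distrib]
    rw [h, Complex.ofReal_add, ← hp, ← hq]
    simp only [cellTrace, polynomialOf_add, add_apply, inner_add_right, Finset.sum_add_distrib]
  | monomial n a =>
    have h : bandIntegral (monomial n a).eval
        = a * ((2 * Real.pi)⁻¹ ^ 2 * ∫ θ in brillouin, ∑ k, band k θ ^ n) := by
      rw [bandIntegral, mul_left_comm a, ← integral_const_mul a]
      simp only [eval_monomial, Finset.mul_sum]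
    rw [h, Complex.ofReal_mul, ← sum_inner_single_Δ_pow hQ, cellTrace, Finset.mul_sum]
    refine Finset.sum_congr rfl fun v _ => ?_
    rw [polynomialOf_monomial, _root_.smul_apply, inner_smul_right]

theorem cellTrace_functionOf {Q : Finset Vertex} (hQ : IsFundamentalDomain Q) {g : ℝ → ℝ}
    (hg : Continuous g) : cellTrace Q (functionOf g Δ) = (bandIntegral g : ℂ) := by
  rw [← sub_eq_zero, ← norm_le_zero_iff]
  refine le_of_forall_pos_le_add fun δ hδ => ?_
  -- The trace over three vertices and the integral over three bands each triple the error `δ / 6`.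
  -- All bands lie in `[0, 3/2]`.
  obtain ⟨p, hp1, hp2⟩ := exists_polynomial_near_on_spectrum Δ (3 / 2) hg
    (show 0 < δ / 6 by positivity)
  have h1 := norm_functionOf_sub_polynomialOf_le isSelfAdjoint_laplacian hg (by positivity) hp1
  have h2 := abs_bandIntegral_sub_le hg p.continuous
    (fun x hx => hp2 x (by rw [abs_of_nonneg hx.1]; exact hx.2))
  have h3 := norm_cellTrace_le hQ (functionOf g Δ - polynomialOf p Δ)
  have e : cellTrace Q (functionOf g Δ) - (bandIntegral g : ℂ)
      = cellTrace Q (functionOf g Δ - polynomialOf p Δ)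
        - ((bandIntegral g - bandIntegral p.eval : ℝ) : ℂ) := by
    rw [cellTrace_sub, cellTrace_polynomialOf hQ]
    push_cast
    ring
  rw [e]
  refine (norm_sub_le _ _).trans ?_
  rw [Complex.norm_real, Real.norm_eq_abs]
  linarith

/-- The volume of the quasimomenta with the `k`-th band in `S`. -/
def bandMeasure (k : Fin 3) (S : Set ℝ) : ℝ := volume.real (brillouin ∩ band k ⁻¹' S)

theorem bandVolume_eq (k : Fin 3) (E : ℝ) : bandVolume k E = bandMeasure k (Set.Iic E) := rfl

theorem tendsto_bandIntegral {g : ℕ → ℝ → ℝ} {S : Set ℝ} (hS : MeasurableSet S)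
    (hg : ∀ n, Continuous (g n)) (hb : ∀ n x, |g n x| ≤ 1)
    (hlim : ∀ x, Tendsto (fun n => g n x) atTop (𝓝 (S.indicator 1 x))) :
    Tendsto (fun n => bandIntegral (g n)) atTop
      (𝓝 ((2 * Real.pi)⁻¹ ^ 2 * ∑ k, bandMeasure k S)) := by
  have := isFiniteMeasure_brillouin
  have e : ∑ k, bandMeasure k S
      = ∫ θ in brillouin, ∑ k, S.indicator (1 : ℝ → ℝ) (band k θ) := by
    have hm : ∀ k, MeasurableSet (band k ⁻¹' S) := fun k => (continuous_band k).measurable hS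
    have h1 : ∀ k θ, S.indicator (1 : ℝ → ℝ) (band k θ) = (band k ⁻¹' S).indicator 1 θ :=
      fun k θ => rfl
    simp only [h1]
    rw [integral_finsetSum]
    · refine Finset.sum_congr rfl fun k _ => ?_
      rw [integral_indicator_one (hm k), measureReal_restrict_apply (hm k), Set.inter_comm]
      rfl
    · intro k _
      exact (integrable_const (1 : ℝ)).indicator (hm k)
  rw [e]
  refine Tendsto.const_mul _ (tendsto_integral_of_dominated_convergence (fun _ => (3 : ℝ))
    (fun n => (integrableOn_sum_band (hg n)).aestronglyMeasurable) (integrable_const _)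
    (fun n => Eventually.of_forall fun θ => ?_) (Eventually.of_forall fun θ => ?_))
  · refine (norm_sum_le_of_le _ fun k _ => hb n (band k θ)).trans ?_
    simp
  · exact tendsto_finsetSum _ fun k _ => hlim _

/-- Both sides are limits of the same quantity, `cellTrace_functionOf` at the ramps: strongly for
operators, by dominated convergence for bands. -/
theorem ids_eq_sum_bandVolume {Q : Finset Vertex} (hQ : IsFundamentalDomain Q) (E : ℝ) :
    ids Q E = 1 / (3 * (2 * Real.pi) ^ 2) * ∑ k, bandVolume k E := by
  have h1 : Tendsto (fun n => cellTrace Q (functionOf (ramp E n) Δ)) atTop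
      (𝓝 (cellTrace Q (spectralProjector Δ E))) :=
    tendsto_finsetSum _ fun v _ =>
      tendsto_const_nhds.inner (tendsto_functionOf_ramp isSelfAdjoint_laplacian E _)
  have h2 := tendsto_bandIntegral measurableSet_Iic (continuous_ramp E) (abs_ramp_le_one E)
    (tendsto_ramp E)
  simp only [cellTrace_functionOf hQ (continuous_ramp E _)] at h1
  have h3 := tendsto_nhds_unique h1 ((Complex.continuous_ofReal.tendsto _).comp h2)
  rw [ids, densityOfStates, card_of_isFundamentalDomain hQ]
  change (cellTrace Q (spectralProjector Δ E)).re / _ = _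
  rw [h3, Complex.ofReal_re]
  simp only [bandVolume_eq]
  push_cast
  field_simp

/-! ### Absence of eigenvalues where no band is constant -/

/-- Continuous functions decreasing to the indicator function of `{E}`. -/
def tent (E : ℝ) (n : ℕ) (x : ℝ) : ℝ := max 0 (1 - n * |x - E|)

theorem continuous_tent (E : ℝ) (n : ℕ) : Continuous (tent E n) := by
  unfold tent
  fun_prop

theorem abs_tent_le_one (E : ℝ) (n : ℕ) (x : ℝ) : |tent E n x| ≤ 1 := by
  rw [tent, abs_of_nonneg (le_max_left _ _), max_le_iff]
  have : 0 ≤ n * |x - E| := by positivity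
  exact ⟨zero_le_one, by linarith⟩

theorem tent_self (E : ℝ) (n : ℕ) : tent E n E = 1 := by simp [tent]

theorem tendsto_tent (E x : ℝ) :
    Tendsto (fun n => tent E n x) atTop (𝓝 (Set.indicator {E} 1 x)) := by
  by_cases h : x = E
  · rw [Set.indicator_of_mem (Set.mem_singleton_iff.2 h), h]
    simp [tent_self]
  · rw [Set.indicator_of_notMem (by simpa using h)]
    have hp : 0 < |x - E| := abs_pos.2 (sub_ne_zero.2 h)
    obtain ⟨N, hN⟩ := exists_nat_gt (1 / |x - E|)
    refine tendsto_const_nhds.congr' (eventually_atTop.2 ⟨N, fun n hn => ?_⟩)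
    have h1 : 1 / |x - E| < n := hN.trans_le (by exact_mod_cast hn)
    rw [div_lt_iff₀ hp] at h1
    change 0 = tent E n x
    rw [tent, max_eq_left (by linarith)]

theorem exists_isFundamentalDomain_mem (v : Vertex) : ∃ Q, IsFundamentalDomain Q ∧ v ∈ Q := by
  refine ⟨Finset.univ.image fun s => (s, v.2), fun u => ⟨v.2 - u.2, ?_, fun γ hγ => ?_⟩, ?_⟩
  · simp [translate]
  · simp only [translate, Finset.mem_image, Finset.mem_univ, true_and, Prod.mk.injEq] at hγ
    obtain ⟨s, -, h⟩ := hγ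
    rw [h]
    abel
  · simp

/-- Since `tent E n` is `1` at `E`, `tent(Δ)` fixes `f`, so `f v = ⟨tent(Δ) δ_v, f⟩`. The squared
norm of `tent(Δ) δ_v` is at most the cell trace of `tent²(Δ)`, which tends to the normalised measure
of the set where a band equals `E`. -/
theorem eq_zero_of_eigenvector {E : ℝ} (hE : ∀ k, bandMeasure k {E} = 0) {f : ℓ²(Vertex, ℂ)}
    (hf : Δ f = (E : ℂ) • f) : f = 0 := by
  have hlim := tendsto_bandIntegral (g := fun n x => tent E n x * tent E n x)
    (measurableSet_singleton E)
    (fun n => (continuous_tent E n).mul (continuous_tent E n))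
    (fun n x => by
      rw [abs_mul]
      exact mul_le_one₀ (abs_tent_le_one E n x) (abs_nonneg _) (abs_tent_le_one E n x))
    (fun x => by
      have h := (tendsto_tent E x).mul (tendsto_tent E x)
      convert h using 2
      by_cases hx : x = E <;> simp [hx])
  simp only [hE, Finset.sum_const_zero, mul_zero] at hlim
  ext v
  obtain ⟨Q, hQ, hv⟩ := exists_isFundamentalDomain_mem v
  have hle : ∀ n, ‖f v‖ ^ 2 ≤ bandIntegral (fun x => tent E n x * tent E n x) * ‖f‖ ^ 2 := by
    intro n
    have hc := continuous_tent E n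
    have h1 : ‖functionOf (tent E n) Δ (lp.single 2 v (1 : ℂ))‖ ^ 2
        ≤ bandIntegral (fun x => tent E n x * tent E n x) := by
      have h := cellTrace_functionOf hQ (hc.mul hc)
      rw [cellTrace] at h
      change ∑ v ∈ Q, inner ℂ _ (functionOf (fun x => tent E n x * tent E n x) Δ _) = _ at h
      simp only [inner_functionOf_mul_self hc, ← Complex.ofReal_sum] at h
      have h' : _ = bandIntegral (fun x => tent E n x * tent E n x) := Complex.ofReal_injective h
      rw [← h']
      exact Finset.single_le_sum
        (f := fun v => ‖functionOf (tent E n) Δ (lp.single 2 v (1 : ℂ))‖ ^ 2)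
        (fun u _ => sq_nonneg _) hv
    have h2 : f v = inner ℂ (functionOf (tent E n) Δ (lp.single 2 v (1 : ℂ))) f := by
      have hs := isSelfAdjoint_functionOf (tent E n) Δ
      rw [← ContinuousLinearMap.adjoint_inner_right, ContinuousLinearMap.isSelfAdjoint_iff'.1 hs,
        functionOf_apply_eigenvector isSelfAdjoint_laplacian hf hc, tent_self, Complex.ofReal_one,
        one_smul, lp.inner_single_left]
      simp
    have h3 : ‖f v‖ ≤ ‖functionOf (tent E n) Δ (lp.single 2 v (1 : ℂ))‖ * ‖f‖ := by
      conv_lhs => rw [h2]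
      exact norm_inner_le_norm _ _
    calc ‖f v‖ ^ 2 ≤ (‖functionOf (tent E n) Δ (lp.single 2 v (1 : ℂ))‖ * ‖f‖) ^ 2 := by gcongr
      _ = ‖functionOf (tent E n) Δ (lp.single 2 v (1 : ℂ))‖ ^ 2 * ‖f‖ ^ 2 := mul_pow _ _ _
      _ ≤ _ := by gcongr
  have h0 := ge_of_tendsto' (hlim.mul_const (‖f‖ ^ 2)) hle
  rw [zero_mul] at h0
  simpa using le_antisymm h0 (sq_nonneg _)

end Kagome

namespace Kagome

open Filter Topology MeasureTheory

/-! ### Volumes of superlevel sets of the dispersion relation -/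

/-- Up to an affine transformation, the dispersion relation. -/
def profile (θ : ℝ × ℝ) : ℝ :=
  Real.cos (θ.2 / 2) * Real.cos (θ.1 - θ.2 / 2) + Real.cos (θ.2 / 2) ^ 2

/-- With `β = θ.2 / 2` and `α = θ.1 - β`, `cos θ.1 + cos (θ.1 - θ.2) = cos (α + β) + cos (α - β) = 2
cos α cos β`. -/
theorem dispersion_eq_profile (θ : ℝ × ℝ) : dispersion θ = 1 + 4 * profile θ := by
  have h1 := Real.cos_add (θ.1 - θ.2 / 2) (θ.2 / 2)
  have h2 := Real.cos_sub (θ.1 - θ.2 / 2) (θ.2 / 2)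
  rw [sub_add_cancel] at h1
  rw [sub_sub, add_halves] at h2
  have h3 : Real.cos θ.2 = 2 * Real.cos (θ.2 / 2) ^ 2 - 1 := by
    rw [← Real.cos_two_mul]; ring_nf
  rw [dispersion, profile, h1, h2, h3]
  ring

theorem continuous_profile : Continuous profile := by
  unfold profile
  fun_prop

theorem profile_add_two_pi (x y : ℝ) : profile (x + 2 * Real.pi, y) = profile (x, y) := by
  simp only [profile]
  rw [show x + 2 * Real.pi - y / 2 = (x - y / 2) + 2 * Real.pi by ring, Real.cos_add_two_pi]

/-- `T` differs from the superlevel set at the height `c` at most on the level set. -/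
structure IsSuperlevel (T : Set (ℝ × ℝ)) (c : ℝ) : Prop where
  measurableSet : MeasurableSet T
  mem_of_lt : ∀ θ, c < profile θ → θ ∈ T
  le_of_mem : ∀ θ ∈ T, c ≤ profile θ
  periodic : ∀ x y, (x + 2 * Real.pi, y) ∈ T ↔ (x, y) ∈ T

theorem isSuperlevel_le (c : ℝ) : IsSuperlevel {θ | c ≤ profile θ} c where
  measurableSet := measurableSet_le measurable_const continuous_profile.measurable
  mem_of_lt _ h := h.le
  le_of_mem _ h := h
  periodic x y := by simp only [Set.mem_ofPred_eq, profile_add_two_pi]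

theorem isSuperlevel_lt (c : ℝ) : IsSuperlevel {θ | c < profile θ} c where
  measurableSet := measurableSet_lt measurable_const continuous_profile.measurable
  mem_of_lt _ h := h
  le_of_mem _ h := h.le
  periodic x y := by simp only [Set.mem_ofPred_eq, profile_add_two_pi]

/-- Within one period `s` lies between the open and the closed interval with endpoints `±arccos x`.
This includes `x` outside `[-1, 1]`, where `Real.arccos` takes the constant values `0` and `π`. -/
theorem integral_indicator_of_cos {s : Set ℝ} (hs : MeasurableSet s) {x : ℝ}
    (h1 : ∀ α, x < Real.cos α → α ∈ s) (h2 : ∀ α ∈ s, x ≤ Real.cos α) :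
    ∫ α in (-Real.pi)..Real.pi, s.indicator (1 : ℝ → ℝ) α = 2 * Real.arccos x := by
  have h0 := Real.arccos_nonneg x
  have hpi := Real.arccos_le_pi x
  rw [intervalIntegral.integral_of_le (by linarith [Real.pi_pos]), integral_indicator_one hs,
    measureReal_restrict_apply hs]
  have hcos : ∀ α ∈ Set.Icc (-Real.pi) Real.pi, Real.arccos (Real.cos α) = |α| := by
    intro α hα
    rw [← Real.cos_abs, Real.arccos_cos (abs_nonneg _) (abs_le.2 hα)]
  have hsub1 : Set.Ioo (-Real.arccos x) (Real.arccos x) ⊆ s ∩ Set.Ioc (-Real.pi) Real.pi := by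
    intro α hα
    have hα' : α ∈ Set.Ioc (-Real.pi) Real.pi := ⟨by linarith [hα.1], by linarith [hα.2]⟩
    refine ⟨h1 α ?_, hα'⟩
    by_contra! hle
    have h3 := Real.antitone_arccos hle
    rw [hcos α (Set.Ioc_subset_Icc_self hα')] at h3
    exact absurd (abs_lt.2 hα) (not_lt.2 h3)
  have hsub2 : s ∩ Set.Ioc (-Real.pi) Real.pi ⊆ Set.Icc (-Real.arccos x) (Real.arccos x) := by
    rintro α ⟨hα, hα'⟩
    have h3 := Real.antitone_arccos (h2 α hα)
    rw [hcos α (Set.Ioc_subset_Icc_self hα')] at h3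
    exact abs_le.1 h3
  have hm1 := measureReal_mono (μ := volume) hsub1
    (((measure_mono hsub2).trans_lt isCompact_Icc.measure_lt_top).ne)
  have hm2 := measureReal_mono (μ := volume) hsub2 isCompact_Icc.measure_lt_top.ne
  rw [Real.volume_real_Ioo_of_le (by linarith)] at hm1
  rw [Real.volume_real_Icc_of_le (by linarith)] at hm2
  linarith

theorem integral_slice {T : Set (ℝ × ℝ)} {c : ℝ} (hT : IsSuperlevel T c) {y : ℝ}
    (hy : Real.cos (y / 2) ≠ 0) :
    ∫ x in 0..2 * Real.pi, T.indicator (1 : ℝ × ℝ → ℝ) (x, y)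
      = 2 * Real.arccos (c / |Real.cos (y / 2)| - |Real.cos (y / 2)|) := by
  obtain ⟨δ, hδ⟩ : ∃ δ, ∀ α, Real.cos (y / 2) * Real.cos (α + δ - y / 2)
      = |Real.cos (y / 2)| * Real.cos α := by
    -- A negative cosine is made positive by shifting the angle by a further `π`.
    rcases lt_or_gt_of_ne hy with h | h
    · refine ⟨y / 2 + Real.pi, fun α => ?_⟩
      rw [show α + (y / 2 + Real.pi) - y / 2 = α + Real.pi by ring, Real.cos_add_pi,
        abs_of_neg h]
      ring
    · refine ⟨y / 2, fun α => ?_⟩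
      rw [add_sub_cancel_right, abs_of_pos h]
  have hprofile : ∀ α, profile (α + δ, y)
      = |Real.cos (y / 2)| * Real.cos α + |Real.cos (y / 2)| ^ 2 := by
    intro α
    rw [profile, hδ, sq_abs]
  have ht : 0 < |Real.cos (y / 2)| := abs_pos.2 hy
  generalize |Real.cos (y / 2)| = t at *
  have hper : Function.Periodic (fun x => T.indicator (1 : ℝ × ℝ → ℝ) (x, y)) (2 * Real.pi) := by
    intro x
    by_cases h : (x, y) ∈ T
    · simp [h, (hT.periodic x y).2 h]
    · simp [h, mt (hT.periodic x y).1 h]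
  have h1 := hper.intervalIntegral_add_eq 0 (δ - Real.pi)
  rw [zero_add] at h1
  rw [h1]
  have h2 := intervalIntegral.integral_comp_add_right
    (a := -Real.pi) (b := Real.pi) (fun x => T.indicator (1 : ℝ × ℝ → ℝ) (x, y)) δ
  rw [show δ - Real.pi + 2 * Real.pi = Real.pi + δ by ring,
    show δ - Real.pi = -Real.pi + δ by ring, ← h2]
  have hm : Measurable fun α : ℝ => (α + δ, y) := by fun_prop
  refine integral_indicator_of_cos (s := (fun α : ℝ => (α + δ, y)) ⁻¹' T)
    (hm hT.measurableSet) (fun α hα => hT.mem_of_lt _ ?_) (fun α hα => ?_)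
  · rw [hprofile]
    rw [sub_lt_iff_lt_add, div_lt_iff₀ ht] at hα
    linarith
  · have h := hT.le_of_mem _ hα
    rw [hprofile] at h
    rw [sub_le_iff_le_add, div_le_iff₀ ht]
    linarith

/-- `∫ arccos (c / cos β - cos β) dβ` over a quarter of a period. -/
def quarterIntegral (c : ℝ) : ℝ :=
  ∫ β in 0..Real.pi / 2, Real.arccos (c / Real.cos β - Real.cos β)

theorem abs_arccos_le (x : ℝ) : |Real.arccos x| ≤ Real.pi := by
  rw [abs_of_nonneg (Real.arccos_nonneg x)]
  exact Real.arccos_le_pi x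

theorem intervalIntegrable_of_abs_le {f : ℝ → ℝ} (hf : Measurable f) {C : ℝ}
    (h : ∀ x, |f x| ≤ C) (a b : ℝ) : IntervalIntegrable f volume a b :=
  (intervalIntegrable_const (c := C)).mono_fun hf.aestronglyMeasurable
    (Eventually.of_forall fun x => (h x).trans (le_abs_self C))

theorem ae_cos_half_ne_zero : ∀ᵐ y ∂(volume : Measure ℝ),
    y ∈ Set.Ioc 0 (2 * Real.pi) → Real.cos (y / 2) ≠ 0 := by
  have h : ∀ᵐ y ∂(volume : Measure ℝ), y ≠ Real.pi := by
    simp [ae_iff]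
  filter_upwards [h] with y hy hy' hcos
  apply hy
  have h1 := Real.arccos_cos (x := y / 2) (by linarith [hy'.1]) (by linarith [hy'.2])
  rw [hcos, Real.arccos_zero] at h1
  linarith

/-- The `8` collects three factors `2`: the slice is a symmetric arc, `y = 2β` rescales the outer
variable, and `[0, π]` consists of two quarters with equal integrals. -/
theorem volume_superlevel {T : Set (ℝ × ℝ)} {c : ℝ} (hT : IsSuperlevel T c) :
    volume.real (brillouin ∩ T) = 8 * quarterIntegral c := by
  set h : ℝ → ℝ := fun t => Real.arccos (c / t - t) with hh
  have hmeas : Measurable h := Real.continuous_arccos.measurable.comp (by fun_prop)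
  have := isFiniteMeasure_brillouin
  have e1 : volume.real (brillouin ∩ T)
      = ∫ y in 0..2 * Real.pi, ∫ x in 0..2 * Real.pi, T.indicator (1 : ℝ × ℝ → ℝ) (x, y) := by
    have hi : Integrable (T.indicator (1 : ℝ × ℝ → ℝ)) (volume.restrict brillouin) :=
      (integrable_const (1 : ℝ)).indicator hT.measurableSet
    rw [Set.inter_comm, ← measureReal_restrict_apply hT.measurableSet,
      ← integral_indicator_one hT.measurableSet]
    rw [brillouin, Measure.volume_eq_prod, ← Measure.prod_restrict] at hi ⊢
    rw [integral_prod_symm _ hi]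
    rw [intervalIntegral.integral_of_le Real.two_pi_pos.le, ← integral_Ico_eq_integral_Ioc]
    refine integral_congr_ae (Eventually.of_forall fun y => ?_)
    change ∫ x in _, _ = ∫ x in 0..2 * Real.pi, _
    rw [intervalIntegral.integral_of_le Real.two_pi_pos.le, ← integral_Ico_eq_integral_Ioc]
  have e2 : ∫ y in 0..2 * Real.pi, ∫ x in 0..2 * Real.pi, T.indicator (1 : ℝ × ℝ → ℝ) (x, y)
      = ∫ y in 0..2 * Real.pi, 2 * h |Real.cos (y / 2)| := by
    refine intervalIntegral.integral_congr_ae ?_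
    filter_upwards [ae_cos_half_ne_zero] with y hy hy'
    rw [Set.uIoc_of_le Real.two_pi_pos.le] at hy'
    exact integral_slice hT (hy hy')
  have e3 : ∫ y in 0..2 * Real.pi, 2 * h |Real.cos (y / 2)|
      = 4 * ∫ β in 0..Real.pi, h |Real.cos β| := by
    rw [intervalIntegral.integral_const_mul,
      intervalIntegral.integral_comp_div (fun β => h |Real.cos β|) two_ne_zero, smul_eq_mul,
      zero_div, mul_div_cancel_left₀ _ two_ne_zero]
    ring
  have hint : ∀ a b, IntervalIntegrable (fun β => h |Real.cos β|) volume a b := fun a b =>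
    intervalIntegrable_of_abs_le
      (hmeas.comp (continuous_abs.comp Real.continuous_cos).measurable)
      (fun x => abs_arccos_le _) a b
  have e4 : ∫ β in 0..Real.pi / 2, h |Real.cos β| = quarterIntegral c := by
    refine intervalIntegral.integral_congr fun β hβ => ?_
    rw [Set.uIcc_of_le (by linarith [Real.pi_pos])] at hβ
    change h |Real.cos β| = h (Real.cos β)
    rw [abs_of_nonneg (Real.cos_nonneg_of_mem_Icc ⟨by linarith [hβ.1, Real.pi_pos], hβ.2⟩)]
  have e5 : ∫ β in Real.pi / 2..Real.pi, h |Real.cos β| = quarterIntegral c := by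
    rw [← e4]
    have h1 := intervalIntegral.integral_comp_sub_left (a := 0) (b := Real.pi / 2)
      (fun β => h |Real.cos β|) Real.pi
    rw [sub_zero, show Real.pi - Real.pi / 2 = Real.pi / 2 by ring] at h1
    rw [← h1]
    simp only [Real.cos_pi_sub, abs_neg]
  rw [e1, e2, e3, ← intervalIntegral.integral_add_adjacent_intervals (hint 0 (Real.pi / 2))
    (hint (Real.pi / 2) Real.pi), e4, e5]
  ring

/-- The strict and the weak superlevel sets have the same volume by `volume_superlevel`, and the
level set is their difference. -/
theorem volume_level (c : ℝ) : volume.real (brillouin ∩ {θ | profile θ = c}) = 0 := by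
  have h1 := volume_superlevel (isSuperlevel_le c)
  rw [← volume_superlevel (isSuperlevel_lt c)] at h1
  have e : brillouin ∩ {θ | profile θ = c}
      = (brillouin ∩ {θ | c ≤ profile θ}) \ (brillouin ∩ {θ | c < profile θ}) := by
    ext θ
    simp only [Set.mem_inter_iff, Set.mem_ofPred_eq, Set.mem_sdiff, not_and, not_lt]
    constructor
    · rintro ⟨h, h'⟩
      exact ⟨⟨h, h'.ge⟩, fun _ => h'.le⟩
    · rintro ⟨⟨h, h'⟩, h''⟩
      exact ⟨h, le_antisymm (h'' h) h'⟩
  rw [e, measureReal_sdiff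
    (show brillouin ∩ {θ | c < profile θ} ⊆ brillouin ∩ {θ | c ≤ profile θ} from
      Set.inter_subset_inter_right _ fun θ (hθ : c < profile θ) => hθ.le)
    (measurableSet_brillouin.inter (isSuperlevel_lt c).measurableSet)
    (((measure_mono Set.inter_subset_left).trans_lt
      (by rw [volume_brillouin]; exact ENNReal.ofReal_lt_top)).ne), h1, sub_self]

/-! ### Band volumes -/

/-- This is where `4E² - 6E + 2` comes from: `band 0 θ` or `band 1 θ` equals `E` only if
`√(dispersion θ) = |4E - 3|`. -/
theorem profile_sub_eq (θ : ℝ × ℝ) (E : ℝ) :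
    dispersion θ - (4 * E - 3) ^ 2 = 4 * (profile θ - (4 * E ^ 2 - 6 * E + 2)) := by
  rw [dispersion_eq_profile]
  ring

theorem band_zero_le_iff {E : ℝ} (hE : E ≤ 3 / 4) (θ : ℝ × ℝ) :
    band 0 θ ≤ E ↔ 4 * E ^ 2 - 6 * E + 2 ≤ profile θ := by
  have h1 : band 0 θ ≤ E ↔ 3 - 4 * E ≤ √(dispersion θ) := by
    rw [band_zero, div_le_iff₀ (by norm_num)]
    constructor <;> intro h <;> linarith
  have h := profile_sub_eq θ E
  rw [h1, Real.le_sqrt (by linarith) (dispersion_nonneg θ)]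
  constructor <;> intro h <;> nlinarith

theorem band_one_le_iff {E : ℝ} (hE : 3 / 4 ≤ E) (θ : ℝ × ℝ) :
    band 1 θ ≤ E ↔ ¬ 4 * E ^ 2 - 6 * E + 2 < profile θ := by
  have h1 : band 1 θ ≤ E ↔ √(dispersion θ) ≤ 4 * E - 3 := by
    rw [band_one, div_le_iff₀ (by norm_num)]
    constructor <;> intro h <;> linarith
  have h := profile_sub_eq θ E
  rw [h1, Real.sqrt_le_left (by linarith), not_lt]
  constructor <;> intro h <;> nlinarith

end Kagome

namespace Kagome

open Filter Topology MeasureTheory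

/-! ### The integrals in the formulas for the density of states -/

theorem image_cos_Ioo : Real.cos '' Set.Ioo 0 (Real.pi / 2) = Set.Ioo 0 1 := by
  ext t
  constructor
  · rintro ⟨β, hβ, rfl⟩
    refine ⟨Real.cos_pos_of_mem_Ioo ⟨by linarith [hβ.1, Real.pi_pos], hβ.2⟩, ?_⟩
    rw [← Real.cos_zero]
    exact Real.cos_lt_cos_of_nonneg_of_le_pi le_rfl (by linarith [hβ.2, Real.pi_pos]) hβ.1
  · intro ht
    refine ⟨Real.arccos t, ⟨Real.arccos_pos.2 ht.2, Real.arccos_lt_pi_div_two.2 ht.1⟩, ?_⟩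
    exact Real.cos_arccos (by linarith [ht.1]) ht.2.le

theorem injOn_cos_Ioo : Set.InjOn Real.cos (Set.Ioo 0 (Real.pi / 2)) :=
  Real.injOn_cos.mono fun β (hβ : β ∈ Set.Ioo 0 (Real.pi / 2)) =>
    Set.mem_Icc.2 ⟨hβ.1.le, by linarith [hβ.2, Real.pi_pos]⟩

theorem abs_neg_sin_smul_div (g : ℝ → ℝ) {β : ℝ} (hβ : β ∈ Set.Ioo 0 (Real.pi / 2)) :
    |-Real.sin β| • (g (Real.cos β) / √(1 - Real.cos β ^ 2)) = g (Real.cos β) := by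
  have hs : 0 < Real.sin β := Real.sin_pos_of_pos_of_lt_pi hβ.1 (by linarith [hβ.2, Real.pi_pos])
  rw [← Real.sin_sq, Real.sqrt_sq hs.le, abs_neg, abs_of_pos hs, smul_eq_mul]
  field_simp

/-- Substitution `t = cos β`; the Jacobian `sin β` cancels `√(1 - t²)`. -/
theorem integral_div_sqrt (g : ℝ → ℝ) :
    ∫ t in 0..1, g t / √(1 - t ^ 2) = ∫ β in 0..Real.pi / 2, g (Real.cos β) := by
  rw [intervalIntegral.integral_of_le zero_le_one,
    intervalIntegral.integral_of_le (by linarith [Real.pi_pos]),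
    integral_Ioc_eq_integral_Ioo, integral_Ioc_eq_integral_Ioo, ← image_cos_Ioo,
    integral_image_eq_integral_abs_deriv_smul measurableSet_Ioo
      (fun β _ => (Real.hasDerivAt_cos β).hasDerivWithinAt) injOn_cos_Ioo]
  exact setIntegral_congr_fun measurableSet_Ioo fun β hβ => abs_neg_sin_smul_div g hβ

theorem intervalIntegrable_div_sqrt {g : ℝ → ℝ} (hg : Measurable g) {C : ℝ}
    (h : ∀ x, |g x| ≤ C) : IntervalIntegrable (fun t => g t / √(1 - t ^ 2)) volume 0 1 := by
  rw [intervalIntegrable_iff_integrableOn_Ioo_of_le zero_le_one, ← image_cos_Ioo,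
    integrableOn_image_iff_integrableOn_abs_deriv_smul measurableSet_Ioo
      (fun β _ => (Real.hasDerivAt_cos β).hasDerivWithinAt) injOn_cos_Ioo]
  have hi := intervalIntegrable_of_abs_le (hg.comp Real.continuous_cos.measurable)
    (fun x => h (Real.cos x)) 0 (Real.pi / 2)
  rw [intervalIntegrable_iff_integrableOn_Ioo_of_le (by linarith [Real.pi_pos])] at hi
  exact hi.congr_fun (fun β hβ => (abs_neg_sin_smul_div g hβ).symm) measurableSet_Ioo

theorem intervalIntegrable_div_sqrt_of_mem {g : ℝ → ℝ} (hg : Measurable g) {C : ℝ}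
    (h : ∀ x, |g x| ≤ C) {a b : ℝ} (ha : a ∈ Set.Icc (0 : ℝ) 1) (hb : b ∈ Set.Icc (0 : ℝ) 1) :
    IntervalIntegrable (fun t => g t / √(1 - t ^ 2)) volume a b := by
  refine (intervalIntegrable_div_sqrt hg h).mono_set ?_
  rw [Set.uIcc_of_le (zero_le_one' ℝ)]
  exact Set.uIcc_subset_Icc ha hb

theorem measurable_arccos_sub (c : ℝ) : Measurable fun t : ℝ => Real.arccos (c / t - t) :=
  Real.continuous_arccos.measurable.comp (by fun_prop)

theorem quarterIntegral_eq (c : ℝ) :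
    quarterIntegral c = ∫ t in 0..1, Real.arccos (c / t - t) / √(1 - t ^ 2) :=
  (integral_div_sqrt fun t => Real.arccos (c / t - t)).symm

/-- For `0 < t ≤ a` one has `t (t + 1) ≤ a (a + 1)`, so the argument is at least `1` and `arccos`
vanishes. -/
theorem quarterIntegral_of_nonneg {a : ℝ} (ha0 : 0 ≤ a) (ha1 : a ≤ 1) :
    quarterIntegral (a * (a + 1))
      = ∫ t in a..1, Real.arccos (a * (a + 1) / t - t) / √(1 - t ^ 2) := by
  have hi := fun x hx y hy => intervalIntegrable_div_sqrt_of_mem (a := x) (b := y)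
    (measurable_arccos_sub (a * (a + 1))) (fun t => abs_arccos_le _) hx hy
  rw [quarterIntegral_eq, ← intervalIntegral.integral_add_adjacent_intervals
    (hi 0 ⟨le_rfl, zero_le_one⟩ a ⟨ha0, ha1⟩) (hi a ⟨ha0, ha1⟩ 1 ⟨zero_le_one, le_rfl⟩)]
  have h0 : ∫ t in 0..a, Real.arccos (a * (a + 1) / t - t) / √(1 - t ^ 2) = ∫ t in 0..a, 0 := by
    refine intervalIntegral.integral_congr_ae (Eventually.of_forall fun t ht => ?_)
    rw [Set.uIoc_of_le ha0] at ht
    rw [Real.arccos_eq_zero.2, zero_div]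
    rw [le_sub_iff_add_le, le_div_iff₀ ht.1]
    nlinarith [ht.1, ht.2]
  rw [h0]
  simp

theorem integral_one_div_sqrt : ∫ t in (0 : ℝ)..1, Real.pi / √(1 - t ^ 2) = Real.pi ^ 2 / 2 := by
  rw [integral_div_sqrt fun _ => Real.pi]
  simp
  ring

/-- Here `π - arccos` is integrated instead. It vanishes where `t (1 - t) ≤ p (1 - p)`, that is,
outside `(p, 1 - p)`, and the reflection `t ↦ -t` turns it back into `arccos`, on `(p - 1, -p)`. -/
theorem quarterIntegral_of_nonpos {p : ℝ} (hp0 : 0 ≤ p) (hp1 : p ≤ 1 / 2) :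
    quarterIntegral (-(p * (1 - p))) = Real.pi ^ 2 / 2
      - ∫ t in (p - 1)..(-p), Real.arccos (-(p * (1 - p)) / t - t) / √(1 - t ^ 2) := by
  have hi := fun x hx y hy => intervalIntegrable_div_sqrt_of_mem (a := x) (b := y)
    (g := fun t => Real.pi - Real.arccos (-(p * (1 - p)) / t - t)) (C := Real.pi)
    ((measurable_arccos_sub _).const_sub _)
    (fun t => by
      rw [abs_of_nonneg (sub_nonneg.2 (Real.arccos_le_pi _))]
      linarith [Real.arccos_nonneg (-(p * (1 - p)) / t - t)]) hx hy
  have m0 : (0 : ℝ) ∈ Set.Icc (0 : ℝ) 1 := ⟨le_rfl, zero_le_one⟩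
  have m1 : (1 : ℝ) ∈ Set.Icc (0 : ℝ) 1 := ⟨zero_le_one, le_rfl⟩
  have mp : p ∈ Set.Icc (0 : ℝ) 1 := ⟨hp0, by linarith⟩
  have mq : 1 - p ∈ Set.Icc (0 : ℝ) 1 := ⟨by linarith, by linarith⟩
  have hrefl : ∫ t in (p - 1)..(-p), Real.arccos (-(p * (1 - p)) / t - t) / √(1 - t ^ 2)
      = ∫ t in p..(1 - p), (Real.pi - Real.arccos (-(p * (1 - p)) / t - t)) / √(1 - t ^ 2) := by
    rw [← neg_sub 1 p, ← intervalIntegral.integral_comp_neg]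
    refine intervalIntegral.integral_congr fun t _ => ?_
    rw [← Real.arccos_neg, neg_sq, div_neg, neg_sub, sub_neg_eq_add, neg_add_eq_sub]
  have htotal : ∫ t in (0 : ℝ)..1, (Real.pi - Real.arccos (-(p * (1 - p)) / t - t)) / √(1 - t ^ 2)
      = Real.pi ^ 2 / 2 - quarterIntegral (-(p * (1 - p))) := by
    rw [quarterIntegral_eq, ← integral_one_div_sqrt, ← intervalIntegral.integral_sub]
    · simp only [sub_div]
    · exact intervalIntegrable_div_sqrt measurable_const fun _ => le_rfl
    · exact intervalIntegrable_div_sqrt (measurable_arccos_sub _) fun t => abs_arccos_le _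
  have hzero : ∀ t : ℝ, 0 < t → (t ≤ p ∨ 1 - p ≤ t) →
      (Real.pi - Real.arccos (-(p * (1 - p)) / t - t)) / √(1 - t ^ 2) = 0 := by
    intro t ht h
    rw [Real.arccos_eq_pi.2, sub_self, zero_div]
    rw [sub_le_iff_le_add, div_le_iff₀ ht]
    rcases h with h | h <;> nlinarith
  have h1 : ∫ t in (0 : ℝ)..p, (Real.pi - Real.arccos (-(p * (1 - p)) / t - t)) / √(1 - t ^ 2)
      = ∫ t in (0 : ℝ)..p, 0 := by
    refine intervalIntegral.integral_congr_ae (Eventually.of_forall fun t ht => ?_)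
    rw [Set.uIoc_of_le hp0] at ht
    exact hzero t ht.1 (Or.inl ht.2)
  have h2 : ∫ t in (1 - p)..1, (Real.pi - Real.arccos (-(p * (1 - p)) / t - t)) / √(1 - t ^ 2)
      = ∫ t in (1 - p)..1, 0 := by
    refine intervalIntegral.integral_congr_ae (Eventually.of_forall fun t ht => ?_)
    rw [Set.uIoc_of_le mq.2] at ht
    exact hzero t (by linarith [ht.1]) (Or.inr ht.1.le)
  have hsplit := intervalIntegral.integral_add_adjacent_intervals (hi 0 m0 p mp)
    (hi p mp 1 m1)
  rw [← intervalIntegral.integral_add_adjacent_intervals (hi p mp (1 - p) mq)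
    (hi (1 - p) mq 1 m1), h1, h2, ← hrefl, htotal] at hsplit
  simp only [intervalIntegral.integral_zero, zero_add, add_zero] at hsplit
  linarith

theorem continuous_quarterIntegral : Continuous quarterIntegral := by
  refine intervalIntegral.continuous_of_dominated_interval (bound := fun _ => Real.pi)
    (fun c => ?_) (fun c => Eventually.of_forall fun β _ => abs_arccos_le _)
    intervalIntegrable_const (Eventually.of_forall fun β _ => ?_)
  · exact ((measurable_arccos_sub c).comp Real.continuous_cos.measurable).aestronglyMeasurable
  · exact Real.continuous_arccos.comp ((continuous_id.div_const _).sub continuous_const)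

theorem quarterIntegral_two : quarterIntegral 2 = 0 := by
  have h := quarterIntegral_of_nonneg zero_le_one le_rfl
  norm_num at h
  exact h

/-! ### The formulas for the density of states -/

theorem bandVolume_of_forall_lt {k : Fin 3} {E : ℝ} (h : ∀ θ, E < band k θ) :
    bandVolume k E = 0 := by
  have e : brillouin ∩ band k ⁻¹' Set.Iic E = ∅ := by
    ext θ
    simpa using fun _ => h θ
  rw [bandVolume_eq, bandMeasure, e, measureReal_empty]

theorem bandVolume_of_forall_le {k : Fin 3} {E : ℝ} (h : ∀ θ, band k θ ≤ E) :
    bandVolume k E = (2 * Real.pi) ^ 2 := by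
  have e : brillouin ∩ band k ⁻¹' Set.Iic E = brillouin := by
    ext θ
    simpa using fun _ => h θ
  rw [bandVolume_eq, bandMeasure, e, volume_real_brillouin]

theorem bandVolume_zero {E : ℝ} (hE : E ≤ 3 / 4) :
    bandVolume 0 E = 8 * quarterIntegral (4 * E ^ 2 - 6 * E + 2) := by
  rw [← volume_superlevel (isSuperlevel_le _), bandVolume_eq, bandMeasure]
  congr 2
  ext θ
  exact band_zero_le_iff hE θ

theorem bandVolume_one {E : ℝ} (hE : 3 / 4 ≤ E) :
    bandVolume 1 E = (2 * Real.pi) ^ 2 - 8 * quarterIntegral (4 * E ^ 2 - 6 * E + 2) := by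
  have hT := isSuperlevel_lt (4 * E ^ 2 - 6 * E + 2)
  have e : brillouin ∩ band 1 ⁻¹' Set.Iic E
      = brillouin \ (brillouin ∩ {θ | 4 * E ^ 2 - 6 * E + 2 < profile θ}) := by
    ext θ
    have h := band_one_le_iff hE θ
    simp only [Set.mem_inter_iff, Set.mem_preimage, Set.mem_Iic, h, Set.mem_sdiff,
      Set.mem_ofPred_eq]
    tauto
  rw [← volume_superlevel hT, bandVolume_eq, bandMeasure, e,
    measureReal_sdiff Set.inter_subset_left (measurableSet_brillouin.inter hT.measurableSet)
    (by rw [volume_brillouin]; exact ENNReal.ofReal_lt_top.ne), volume_real_brillouin]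

theorem ids_of_neg {Q : Finset Vertex} (hQ : IsFundamentalDomain Q) {E : ℝ}
    (hE : E < 0) : ids Q E = 0 := by
  rw [ids_eq_sum_bandVolume hQ, Finset.sum_eq_zero, mul_zero]
  exact fun k _ => bandVolume_of_forall_lt fun θ => hE.trans_le (band_mem_Icc k θ).1

theorem ids_of_ge {Q : Finset Vertex} (hQ : IsFundamentalDomain Q) {E : ℝ}
    (hE : 3 / 2 ≤ E) : ids Q E = 1 := by
  rw [ids_eq_sum_bandVolume hQ,
    Finset.sum_congr rfl fun k _ =>
      bandVolume_of_forall_le fun θ => (band_mem_Icc k θ).2.trans hE]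
  have := Real.pi_ne_zero
  simp
  field_simp

theorem ids_of_lt {Q : Finset Vertex} (hQ : IsFundamentalDomain Q) {E : ℝ}
    (hE : E < 3 / 4) :
    ids Q E = 2 / (3 * Real.pi ^ 2) * quarterIntegral (4 * E ^ 2 - 6 * E + 2) := by
  rw [ids_eq_sum_bandVolume hQ, Fin.sum_univ_three, bandVolume_zero hE.le,
    bandVolume_of_forall_lt (k := 1), bandVolume_of_forall_lt (k := 2)]
  · have := Real.pi_ne_zero
    field_simp
    ring
  · intro θ
    rw [band_two]
    linarith
  · intro θ
    rw [band_one]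
    linarith [Real.sqrt_nonneg (dispersion θ)]

theorem ids_of_mem_Ico {Q : Finset Vertex} (hQ : IsFundamentalDomain Q) {E : ℝ}
    (hE : E ∈ Set.Ico (3 / 4) (3 / 2)) :
    ids Q E = 2 / 3 - 2 / (3 * Real.pi ^ 2) * quarterIntegral (4 * E ^ 2 - 6 * E + 2) := by
  rw [ids_eq_sum_bandVolume hQ, Fin.sum_univ_three, bandVolume_one hE.1,
    bandVolume_of_forall_le (k := 0), bandVolume_of_forall_lt (k := 2)]
  · have := Real.pi_ne_zero
    field_simp
    ring
  · intro θ
    rw [band_two]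
    exact hE.2
  · intro θ
    rw [band_zero]
    linarith [Real.sqrt_nonneg (dispersion θ), hE.1]

theorem ids_first {Q : Finset Vertex} (hQ : IsFundamentalDomain Q) {E : ℝ}
    (h1 : 0 ≤ E) (h2 : E < 1 / 2) :
    ids Q E = 2 / (3 * Real.pi ^ 2) * arccosIntegral E (1 - 2 * E) 1 := by
  have h := quarterIntegral_of_nonneg (a := 1 - 2 * E) (by linarith) (by linarith)
  rw [show (1 - 2 * E) * (1 - 2 * E + 1) = 4 * E ^ 2 - 6 * E + 2 by ring] at h
  rw [ids_of_lt hQ (by linarith), h, arccosIntegral]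

theorem ids_second {Q : Finset Vertex} (hQ : IsFundamentalDomain Q) {E : ℝ}
    (h1 : 1 / 2 ≤ E) (h2 : E < 3 / 4) :
    ids Q E = 1 / 3 - 2 / (3 * Real.pi ^ 2) * arccosIntegral E (2 * E - 2) (1 - 2 * E) := by
  have h := quarterIntegral_of_nonpos (p := 2 * E - 1) (by linarith) (by linarith)
  rw [show -((2 * E - 1) * (1 - (2 * E - 1))) = 4 * E ^ 2 - 6 * E + 2 by ring,
    show 2 * E - 1 - 1 = 2 * E - 2 by ring, show -(2 * E - 1) = 1 - 2 * E by ring] at h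
  rw [ids_of_lt hQ (by linarith), h, arccosIntegral]
  have := Real.pi_ne_zero
  field_simp

theorem ids_third {Q : Finset Vertex} (hQ : IsFundamentalDomain Q) {E : ℝ}
    (h1 : 3 / 4 ≤ E) (h2 : E < 1) :
    ids Q E = 1 / 3 + 2 / (3 * Real.pi ^ 2) * arccosIntegral E (1 - 2 * E) (2 * E - 2) := by
  have h := quarterIntegral_of_nonpos (p := 2 - 2 * E) (by linarith) (by linarith)
  rw [show -((2 - 2 * E) * (1 - (2 - 2 * E))) = 4 * E ^ 2 - 6 * E + 2 by ring,
    show 2 - 2 * E - 1 = 1 - 2 * E by ring, show -(2 - 2 * E) = 2 * E - 2 by ring] at h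
  rw [ids_of_mem_Ico hQ ⟨h1, by linarith⟩, h, arccosIntegral]
  have := Real.pi_ne_zero
  field_simp
  ring

theorem ids_fourth {Q : Finset Vertex} (hQ : IsFundamentalDomain Q) {E : ℝ}
    (h1 : 1 ≤ E) (h2 : E < 3 / 2) :
    ids Q E = 2 / 3 - 2 / (3 * Real.pi ^ 2) * arccosIntegral E (2 * E - 2) 1 := by
  have h := quarterIntegral_of_nonneg (a := 2 * E - 2) (by linarith) (by linarith)
  rw [show (2 * E - 2) * (2 * E - 2 + 1) = 4 * E ^ 2 - 6 * E + 2 by ring] at h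
  rw [ids_of_mem_Ico hQ ⟨by linarith, h2⟩, h, arccosIntegral]

/-- At `E = 3/2` the level is `c = 2`, the maximum of `profile`, where `quarterIntegral` vanishes;
the limit follows by continuity in `c`. -/
theorem tendsto_ids {Q : Finset Vertex} (hQ : IsFundamentalDomain Q) :
    Tendsto (ids Q) (𝓝[<] (3 / 2)) (𝓝 (2 / 3)) := by
  have hc : Continuous fun E : ℝ =>
      2 / 3 - 2 / (3 * Real.pi ^ 2) * quarterIntegral (4 * E ^ 2 - 6 * E + 2) :=
    continuous_const.sub (continuous_const.mul (continuous_quarterIntegral.comp (by fun_prop)))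
  have h := hc.tendsto (3 / 2)
  rw [show 4 * (3 / 2 : ℝ) ^ 2 - 6 * (3 / 2) + 2 = 2 by norm_num, quarterIntegral_two, mul_zero,
    sub_zero] at h
  refine (h.mono_left nhdsWithin_le_nhds).congr' ?_
  have hmem : Set.Ico (3 / 4 : ℝ) (3 / 2) ∈ 𝓝[<] (3 / 2 : ℝ) :=
    Ico_mem_nhdsLT (by norm_num)
  filter_upwards [hmem] with E hE
  exact (ids_of_mem_Ico hQ hE).symm

/-- Either moving band equals `E` only inside a level set of `profile`, which is null. -/
theorem bandMeasure_singleton (k : Fin 3) {E : ℝ} (hE : E ≠ 3 / 2) : bandMeasure k {E} = 0 := by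
  have hle : ∀ S ⊆ {θ | profile θ = 4 * E ^ 2 - 6 * E + 2}, volume.real (brillouin ∩ S) = 0 := by
    intro S hS
    refine le_antisymm ?_ measureReal_nonneg
    rw [← volume_level (4 * E ^ 2 - 6 * E + 2)]
    exact measureReal_mono (Set.inter_subset_inter_right _ hS)
      (((measure_mono Set.inter_subset_left).trans_lt
        (by rw [volume_brillouin]; exact ENNReal.ofReal_lt_top)).ne)
  have hsq : ∀ θ, (√(dispersion θ)) ^ 2 = (4 * E - 3) ^ 2 →
      profile θ = 4 * E ^ 2 - 6 * E + 2 := by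
    intro θ h
    rw [Real.sq_sqrt (dispersion_nonneg θ)] at h
    linarith [profile_sub_eq θ E]
  rw [bandMeasure]
  fin_cases k
  · refine hle _ fun θ hθ => hsq θ ?_
    have h : band 0 θ = E := hθ
    rw [← h, band_zero]
    ring
  · refine hle _ fun θ hθ => hsq θ ?_
    have h : band 1 θ = E := hθ
    rw [← h, band_one]
    ring
  · refine hle _ fun θ hθ => absurd ?_ hE
    have h : band 2 θ = E := hθ
    rw [← h, band_two]

theorem eigenvalue_eq {E : ℂ} {f : ℓ²(Vertex, ℂ)} (hf0 : f ≠ 0) (hf : Δ f = E • f) :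
    E = 3 / 2 := by
  have him := IsSelfAdjoint.eigenvalue_im_eq_zero isSelfAdjoint_laplacian hf0 hf
  have hre : E = (E.re : ℂ) := Complex.ext rfl (by simpa using him)
  by_contra hne
  refine hf0 (eq_zero_of_eigenvector (E := E.re)
    (fun k => bandMeasure_singleton k fun h => hne ?_) (by rw [← hre]; exact hf))
  rw [hre, h]
  push_cast
  rfl

end Kagome

namespace Kagome

open Filter Topology

/-! ### Functions on the lattice `ℤ²` -/

/-- A general group `M` allows function-valued sequences, so that all columns of a lattice can be
summed at once. -/
theorem exists_antidifference {M : Type*} [AddCommGroup M] (g : ℤ → M) :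
    ∃ G : ℤ → M, ∀ n, G (n + 1) = G n + g n := by
  refine ⟨fun n => match n with
    | Int.ofNat n => ∑ i ∈ Finset.range n, g i
    | Int.negSucc n => -∑ i ∈ Finset.range (n + 1), g (Int.negSucc i), fun n => ?_⟩
  match n with
  | Int.ofNat n => exact Finset.sum_range_succ (fun i : ℕ => g i) n
  | Int.negSucc 0 =>
    change ∑ i ∈ Finset.range 0, g i = -∑ i ∈ Finset.range 1, g (Int.negSucc i) + _
    simp
  | Int.negSucc (n + 1) =>
    change -∑ i ∈ Finset.range (n + 1), g (Int.negSucc i)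
      = -∑ i ∈ Finset.range (n + 1 + 1), g (Int.negSucc i) + _
    rw [Finset.sum_range_succ _ (n + 1)]
    abel

/-- Harmonic functions on the triangular lattice. -/
def IsHarmonic {M : Type*} [AddCommGroup M] (u : ℤ × ℤ → M) : Prop :=
  ∀ m n, 6 • u (m, n) = u (m + 1, n) + u (m - 1, n) + u (m, n + 1) + u (m, n - 1)
    + u (m + 1, n - 1) + u (m - 1, n + 1)

/-- By decay a positive value would yield an attained maximum. Harmonicity makes all neighbours of a
maximum point maximal too, so the maximum propagates along a ray, contradicting decay. -/
theorem IsHarmonic.le_zero {u : ℤ × ℤ → ℝ} (hu : IsHarmonic u)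
    (h0 : Tendsto u cofinite (𝓝 0)) (γ : ℤ × ℤ) : u γ ≤ 0 := by
  by_contra! hpos
  have hfin : {δ | u γ ≤ u δ}.Finite := by
    have h := h0.eventually (gt_mem_nhds hpos)
    rw [eventually_cofinite] at h
    simpa only [not_lt] using h
  obtain ⟨δ, hδ, hmax⟩ := Set.exists_max_image _ u hfin ⟨γ, show u γ ≤ u γ from le_rfl⟩
  have hle : ∀ η, u η ≤ u δ := by
    intro η
    by_cases h : u γ ≤ u η
    · exact hmax η h
    · exact (not_le.1 h).le.trans hδ
  have hline : ∀ k : ℕ, u (δ.1 + k, δ.2) = u δ := by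
    intro k
    induction k with
    | zero => simp
    | succ k ih =>
      have h := hu (δ.1 + k) δ.2
      rw [ih, nsmul_eq_mul] at h
      have e : δ.1 + ((k + 1 : ℕ) : ℤ) = δ.1 + k + 1 := by push_cast; ring
      rw [e]
      refine le_antisymm (hle _) ?_
      push_cast at h
      linarith [hle (δ.1 + k - 1, δ.2), hle (δ.1 + k, δ.2 + 1), hle (δ.1 + k, δ.2 - 1),
        hle (δ.1 + k + 1, δ.2 - 1), hle (δ.1 + k - 1, δ.2 + 1)]
  have hinj : Function.Injective fun k : ℕ => ((δ.1 + k, δ.2) : ℤ × ℤ) := by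
    intro j k h
    simpa using h
  have hlim : Tendsto (fun k : ℕ => u (δ.1 + k, δ.2)) atTop (𝓝 0) :=
    h0.comp (hinj.tendsto_cofinite.comp Nat.cofinite_eq_atTop.ge)
  have hzero := tendsto_nhds_unique hlim
    (tendsto_const_nhds.congr fun k => (hline k).symm)
  have hδ' : u γ ≤ u δ := hδ
  linarith

theorem IsHarmonic.eq_zero {u : ℤ × ℤ → ℂ} (hu : IsHarmonic u)
    (h0 : Tendsto u cofinite (𝓝 0)) (γ : ℤ × ℤ) : u γ = 0 := by
  have key : ∀ L : ℂ →L[ℝ] ℝ, L (u γ) = 0 := by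
    have hle : ∀ L : ℂ →L[ℝ] ℝ, L (u γ) ≤ 0 := by
      intro L
      refine IsHarmonic.le_zero (u := fun γ => L (u γ)) (fun m n => ?_) ?_ γ
      · have h := congrArg L (hu m n)
        simpa only [map_add, map_nsmul] using h
      · have h := (L.continuous.tendsto 0).comp h0
        rwa [map_zero] at h
    intro L
    have h := hle (-L)
    rw [neg_apply] at h
    linarith [hle L]
  exact Complex.ext (key Complex.reCLM) (key Complex.imCLM)

/-! ### The eigenfunctions supported on hexagons -/

theorem tendsto_cofinite_of_l2 {V : Type*} (f : ℓ²(V, ℂ)) :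
    Tendsto (f : V → ℂ) cofinite (𝓝 0) := by
  have h := (lp.memℓp f).summable (by norm_num)
  have h2 := h.tendsto_cofinite_zero
  rw [tendsto_zero_iff_norm_tendsto_zero]
  have h3 := (Real.continuous_sqrt.tendsto 0).comp h2
  rw [Real.sqrt_zero] at h3
  refine h3.congr fun v => ?_
  simp

/-- The function with alternating values `1` and `-1` at the vertices of a hexagon. -/
def hexagonFunction (c : ℤ × ℤ) : ℓ²(Vertex, ℂ) :=
  lp.single 2 (0, c) 1 - lp.single 2 (0, c - (0, 1)) 1
    + (lp.single 2 (1, c + (1, -1)) 1 - lp.single 2 (1, c) 1)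
    + (lp.single 2 (2, c) 1 - lp.single 2 (2, c + (1, 0)) 1)

theorem hexagonFunction_apply (c : ℤ × ℤ) (v : Vertex) : hexagonFunction c v
    = (Pi.single (0, c) 1 : Vertex → ℂ) v - (Pi.single (0, c - (0, 1)) 1 : Vertex → ℂ) v
    + ((Pi.single (1, c + (1, -1)) 1 : Vertex → ℂ) v - (Pi.single (1, c) 1 : Vertex → ℂ) v)
    + ((Pi.single (2, c) 1 : Vertex → ℂ) v - (Pi.single (2, c + (1, 0)) 1 : Vertex → ℂ) v) := by
  simp only [hexagonFunction, lp.coeFn_add, lp.coeFn_sub, lp.coeFn_single, Pi.add_apply,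
    Pi.sub_apply]

theorem hexagonFunction_zero (c : ℤ × ℤ) (m n : ℤ) : hexagonFunction c (0, m, n)
    = (if c = (m, n) then 1 else 0) - (if c = (m, n + 1) then 1 else 0) := by
  obtain ⟨p, q⟩ := c
  rw [hexagonFunction_apply]
  simp only [Pi.single_apply, Prod.mk.injEq, Prod.mk_add_mk, Prod.mk_sub_mk]
  simp
  grind

theorem hexagonFunction_one (c : ℤ × ℤ) (m n : ℤ) : hexagonFunction c (1, m, n)
    = (if c = (m - 1, n + 1) then 1 else 0) - (if c = (m, n) then 1 else 0) := by
  obtain ⟨p, q⟩ := c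
  rw [hexagonFunction_apply]
  simp only [Pi.single_apply, Prod.mk.injEq, Prod.mk_add_mk, Prod.mk_sub_mk]
  simp
  grind

theorem hexagonFunction_two (c : ℤ × ℤ) (m n : ℤ) : hexagonFunction c (2, m, n)
    = (if c = (m, n) then 1 else 0) - (if c = (m - 1, n) then 1 else 0) := by
  obtain ⟨p, q⟩ := c
  rw [hexagonFunction_apply]
  simp only [Pi.single_apply, Prod.mk.injEq, Prod.mk_add_mk, Prod.mk_sub_mk]
  simp
  grind

theorem mem_hexagon_iff (p q : ℤ) (v : Vertex) : v ∈ hexagon (p, q) ↔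
    v = (0, p, q) ∨ v = (1, p, q) ∨ v = (2, p, q) ∨ v = (0, p, q - 1) ∨ v = (1, p + 1, q - 1) ∨
      v = (2, p + 1, q) := by
  obtain ⟨s, m, n⟩ := v
  change sqLength (_, _) = 1 ↔ _
  rw [sqLength_eq_one_iff]
  fin_cases s <;> simp [position, offset] <;> omega

theorem hexagonFunction_of_notMem {c : ℤ × ℤ} {v : Vertex} (hv : v ∉ hexagon c) :
    hexagonFunction c v = 0 := by
  obtain ⟨p, q⟩ := c
  rw [mem_hexagon_iff] at hv
  rw [hexagonFunction_apply]
  simp only [Pi.single_apply, Prod.mk_add_mk, Prod.mk_sub_mk, sub_zero, add_zero,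
    ← sub_eq_add_neg]
  grind

theorem hexagonFunction_values (p q : ℤ) :
    hexagonFunction (p, q) (0, p, q) = 1 ∧ hexagonFunction (p, q) (1, p, q) = -1 ∧
    hexagonFunction (p, q) (2, p, q) = 1 ∧ hexagonFunction (p, q) (0, p, q - 1) = -1 ∧
    hexagonFunction (p, q) (1, p + 1, q - 1) = 1 ∧
    hexagonFunction (p, q) (2, p + 1, q) = -1 := by
  simp [hexagonFunction_zero, hexagonFunction_one, hexagonFunction_two, eq_sub_iff_add_eq]

theorem hexagonFunction_eq_one_or (c : ℤ × ℤ) (v : Vertex) (hv : v ∈ hexagon c) :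
    hexagonFunction c v = 1 ∨ hexagonFunction c v = -1 := by
  obtain ⟨p, q⟩ := c
  obtain ⟨h1, h2, h3, h4, h5, h6⟩ := hexagonFunction_values p q
  rcases (mem_hexagon_iff p q v).1 hv with rfl | rfl | rfl | rfl | rfl | rfl <;> simp [*]

theorem hexagonFunction_alternating (c : ℤ × ℤ) (v : Vertex) (hv : v ∈ hexagon c) (w : Vertex)
    (hw : w ∈ hexagon c) (hvw : graph.Adj v w) : hexagonFunction c w = -hexagonFunction c v := by
  obtain ⟨p, q⟩ := c
  obtain ⟨h1, h2, h3, h4, h5, h6⟩ := hexagonFunction_values p q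
  rw [adj_iff_mem_neighbours] at hvw
  rcases (mem_hexagon_iff p q v).1 hv with rfl | rfl | rfl | rfl | rfl | rfl <;>
  rcases (mem_hexagon_iff p q w).1 hw with rfl | rfl | rfl | rfl | rfl | rfl <;>
  first
  | (simp [*]; done)
  | (exfalso; simp [neighbours] at hvw; try omega)

theorem Δ_eq_smul_iff (f : ℓ²(Vertex, ℂ)) (E : ℂ) :
    Δ f = E • f ↔ ∀ v, laplacian graph f v = E * f v := by
  constructor
  · intro h v
    exact congrArg (fun g : ℓ²(Vertex, ℂ) => g v) h
  · intro h
    ext v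
    exact h v

theorem Δ_hexagonFunction (c : ℤ × ℤ) :
    Δ (hexagonFunction c) = (3 / 2 : ℂ) • hexagonFunction c := by
  rw [Δ_eq_smul_iff]
  rintro ⟨s, m, n⟩
  fin_cases s
  · simp only [Fin.zero_eta, laplacian_graph_zero, hexagonFunction_zero, hexagonFunction_one,
      hexagonFunction_two, add_sub_cancel_right]
    ring
  · simp only [Fin.mk_one, laplacian_graph_one, hexagonFunction_zero, hexagonFunction_one,
      hexagonFunction_two]
    ring
  · simp only [Fin.reduceFinMk, laplacian_graph_two, hexagonFunction_zero, hexagonFunction_one,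
      hexagonFunction_two, sub_add_cancel]
    ring

/-- The vertex outside the hexagon that forms a triangle with one of its edges sees only the two
ends of that edge, so the eigenvalue equation there, for any `E`, makes the two values opposite.
Five of the six edges suffice. -/
theorem eq_smul_hexagonFunction (c : ℤ × ℤ) {E : ℂ} {f : ℓ²(Vertex, ℂ)} (hf : Δ f = E • f)
    (hs : ∀ v ∉ hexagon c, f v = 0) : ∃ a : ℂ, f = a • hexagonFunction c := by
  obtain ⟨p, q⟩ := c
  rw [Δ_eq_smul_iff] at hf
  have hz : ∀ v, v ∉ hexagon (p, q) → f v = 0 := hs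
  simp only [mem_hexagon_iff] at hz
  have e1 := hf (2, p, q + 1)
  have e2 := hf (0, p - 1, q)
  have e3 := hf (1, p, q - 1)
  have e4 := hf (2, p + 1, q - 1)
  have e5 := hf (0, p + 1, q - 1)
  rw [laplacian_graph_two, hz (2, p, q + 1) (by simp), hz (0, p - 1, q + 1) (by simp),
    hz (1, p, q + 1) (by simp), add_sub_cancel_right] at e1
  rw [laplacian_graph_zero, hz (0, p - 1, q) (by simp), hz (1, p - 1, q) (by simp; omega),
    hz (2, p - 1, q + 1) (by simp), sub_add_cancel] at e2
  rw [laplacian_graph_one, hz (1, p, q - 1) (by simp), hz (0, p - 1, q - 1) (by simp),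
    hz (2, p, q - 1) (by simp), sub_add_cancel] at e3
  rw [laplacian_graph_two, hz (2, p + 1, q - 1) (by simp), hz (0, p + 1, q - 1 - 1) (by simp),
    hz (1, p + 1, q - 1 - 1) (by simp), add_sub_cancel_right] at e4
  rw [laplacian_graph_zero, hz (0, p + 1, q - 1) (by simp), hz (1, p + 1 + 1, q - 1) (by simp),
    hz (2, p + 1 + 1, q - 1) (by simp), sub_add_cancel] at e5
  obtain ⟨h1, h2, h3, h4, h5, h6⟩ := hexagonFunction_values p q
  refine ⟨f (0, p, q), ?_⟩
  ext v
  change f v = f (0, p, q) * hexagonFunction (p, q) v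
  by_cases hv : v ∈ hexagon (p, q)
  · rcases (mem_hexagon_iff p q v).1 hv with rfl | rfl | rfl | rfl | rfl | rfl
    · rw [h1]; ring
    · rw [h2]; linear_combination -4 * e1
    · rw [h3]; linear_combination 4 * e1 - 4 * e2
    · rw [h4]; linear_combination -4 * e1 + 4 * e2 - 4 * e3
    · rw [h5]; linear_combination 4 * e1 - 4 * e2 + 4 * e3 - 4 * e4
    · rw [h6]; linear_combination -4 * e1 + 4 * e2 - 4 * e3 + 4 * e4 - 4 * e5
  · rw [hs v hv, hexagonFunction_of_notMem hv, mul_zero]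

/-! ### The eigenspace of the constant band -/

section

variable {f : ℓ²(Vertex, ℂ)}

/-- At eigenvalue `3/2` the neighbours of a vertex sum to `-2 f v`, so the two triangles through it
have opposite sums. Along a row the sums alternate between `U` and `-U`, and decay forces `U = 0`.
-/
theorem triangle_sum_eq_zero (hf : Δ f = (3 / 2 : ℂ) • f) (m n : ℤ) :
    f (0, m, n) + f (1, m, n) + f (2, m, n + 1) = 0 ∧
    f (0, m, n) + f (1, m + 1, n) + f (2, m + 1, n) = 0 := by
  rw [Δ_eq_smul_iff] at hf
  set U : ℤ → ℂ := fun m => f (0, m, n) + f (1, m, n) + f (2, m, n + 1) with hU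
  have hadj : ∀ m, f (0, m, n) + f (1, m + 1, n) + f (2, m + 1, n) = -U m := by
    intro m
    have h := hf (0, m, n)
    rw [laplacian_graph_zero] at h
    simp only [hU]
    linear_combination -4 * h
  have hstep : ∀ m, U (m + 1) = U m := by
    intro m
    have h := hf (1, m + 1, n)
    rw [laplacian_graph_one, add_sub_cancel_right] at h
    have h' := hadj m
    simp only [hU] at h' ⊢
    linear_combination -4 * h - h'
  have hconst : ∀ k : ℕ, U (m + k) = U m := by
    intro k
    induction k with
    | zero => simp
    | succ k ih => rw [← ih, ← hstep (m + k)]; push_cast; rw [add_assoc]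
  have hlim : ∀ (s : Fin 3) (j : ℤ), Tendsto (fun k : ℕ => f (s, m + k, j)) atTop (𝓝 0) := by
    intro s j
    have hinj : Function.Injective fun k : ℕ => ((s, m + k, j) : Vertex) := by
      intro j k h
      simpa using h
    exact (tendsto_cofinite_of_l2 f).comp (hinj.tendsto_cofinite.comp Nat.cofinite_eq_atTop.ge)
  have hU0 : Tendsto (fun k : ℕ => U (m + k)) atTop (𝓝 (0 + 0 + 0)) :=
    ((hlim 0 n).add (hlim 1 n)).add (hlim 2 (n + 1))
  have hzero : 0 + 0 + 0 = U m :=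
    tendsto_nhds_unique hU0 (tendsto_const_nhds.congr fun k => (hconst k).symm)
  rw [add_zero, add_zero] at hzero
  refine ⟨hzero.symm, ?_⟩
  rw [hadj, ← hzero, neg_zero]

theorem exists_potential (hf : Δ f = (3 / 2 : ℂ) • f) : ∃ a : ℤ × ℤ → ℂ, ∀ m n,
    f (0, m, n) = a (m, n) - a (m, n + 1) ∧ f (1, m, n) = a (m - 1, n + 1) - a (m, n) ∧
    f (2, m, n) = a (m, n) - a (m - 1, n) := by
  have ht := triangle_sum_eq_zero hf
  obtain ⟨b, hb⟩ := exists_antidifference fun m => f (2, m + 1, 0)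
  obtain ⟨a, ha⟩ := exists_antidifference fun n m => -f (0, m, n)
  have ha' : ∀ m n, a (n + 1) m = a n m - f (0, m, n) := by
    intro m n
    rw [ha, Pi.add_apply, sub_eq_add_neg]
  -- A correction depending on `m` alone leaves the differences in `n` unchanged and gives `A (m, 0)
  -- = b m`.
  set A : ℤ × ℤ → ℂ := fun c => a c.2 c.1 + (b c.1 - a 0 c.1) with hA
  have h0 : ∀ m n, f (0, m, n) = A (m, n) - A (m, n + 1) := by
    intro m n
    simp only [hA, ha']
    ring
  have h2 : ∀ n m, f (2, m, n) = A (m, n) - A (m - 1, n) := by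
    intro n
    -- Two triangles sharing the vertex `(1, m, n)` show that the defect is the same in consecutive
    -- rows; it vanishes in row `0` by the choice of `b`.
    have step : ∀ n m, f (2, m, n + 1) - (A (m, n + 1) - A (m - 1, n + 1))
        = f (2, m, n) - (A (m, n) - A (m - 1, n)) := by
      intro n m
      have t1 := (ht m n).1
      have t2 := (ht (m - 1) n).2
      rw [sub_add_cancel] at t2
      linear_combination t1 - t2 - h0 m n + h0 (m - 1) n
    induction n using Int.induction_on with
    | zero =>
      intro m
      have h := hb (m - 1)
      rw [sub_add_cancel] at h
      simp only [hA, h]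
      ring
    | succ n ih =>
      intro m
      rw [← sub_eq_zero, step, ih, sub_self]
    | pred n ih =>
      intro m
      have h := step (-n - 1) m
      rw [sub_add_cancel, ih, sub_self] at h
      exact sub_eq_zero.1 h.symm
  refine ⟨A, fun m n => ⟨h0 m n, ?_, h2 n m⟩⟩
  linear_combination (ht m n).1 - h0 m n - h2 (n + 1) m

/-- Each vertex lies on exactly two hexagons, whose functions have opposite signs there; the sum has
at most two nonzero terms. -/
theorem hasSum_hexagonFunction {a : ℤ × ℤ → ℂ}
    (ha : ∀ m n, f (0, m, n) = a (m, n) - a (m, n + 1) ∧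
      f (1, m, n) = a (m - 1, n + 1) - a (m, n) ∧ f (2, m, n) = a (m, n) - a (m - 1, n))
    (v : Vertex) : HasSum (fun c => a c * hexagonFunction c v) (f v) := by
  have key : ∀ c₁ c₂ : ℤ × ℤ, HasSum
      (fun c => a c * ((if c = c₁ then 1 else 0) - (if c = c₂ then 1 else 0))) (a c₁ - a c₂) := by
    intro c₁ c₂
    refine ((hasSum_ite_eq c₁ (a c₁)).sub (hasSum_ite_eq c₂ (a c₂))).congr_fun fun c => ?_
    split_ifs <;> simp_all
  obtain ⟨s, m, n⟩ := v
  obtain ⟨h0, h1, h2⟩ := ha m n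
  fin_cases s
  · simp only [Fin.zero_eta, hexagonFunction_zero, h0, key]
  · simp only [Fin.mk_one, hexagonFunction_one, h1, key]
  · simp only [Fin.reduceFinMk, hexagonFunction_two, h2, key]

theorem inner_hexagonFunction (c : ℤ × ℤ) (f : ℓ²(Vertex, ℂ)) :
    inner ℂ (hexagonFunction c) f = f (0, c) - f (0, c - (0, 1))
      + (f (1, c + (1, -1)) - f (1, c)) + (f (2, c) - f (2, c + (1, 0))) := by
  simp only [hexagonFunction, inner_add_left, inner_sub_left, lp.inner_single_left]
  simp

/-- In terms of the potential, orthogonality to `hexagonFunction c` is the harmonic equation for `a`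
at `c`. The potential need not decay, but its differences do: they are the values of `f`, and they
are harmonic as well. -/
theorem eq_zero_of_inner_hexagonFunction (hf : Δ f = (3 / 2 : ℂ) • f)
    (h : ∀ c, inner ℂ (hexagonFunction c) f = 0) : f = 0 := by
  obtain ⟨a, ha⟩ := exists_potential hf
  have hharm : ∀ m n, 6 * a (m, n) = a (m + 1, n) + a (m - 1, n) + a (m, n + 1) + a (m, n - 1)
      + a (m + 1, n - 1) + a (m - 1, n + 1) := by
    intro m n
    have h' := h (m, n)
    rw [inner_hexagonFunction] at h'
    simp only [Prod.mk_add_mk, Prod.mk_sub_mk, sub_zero, add_zero, ← sub_eq_add_neg, ha,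
      sub_add_cancel, add_sub_cancel_right] at h'
    linear_combination h'
  have hs : ∀ s : Fin 3, Tendsto (fun γ => f (s, γ)) cofinite (𝓝 0) := fun s =>
    (tendsto_cofinite_of_l2 f).comp (Prod.mk_right_injective s).tendsto_cofinite
  have hh : ∀ s : Fin 3, IsHarmonic fun γ => f (s, γ) := by
    intro s m n
    have e1 : m + 1 - 1 = m - 1 + 1 := by ring
    have e2 : n + 1 - 1 = n - 1 + 1 := by ring
    fin_cases s
    · simp only [Fin.zero_eta, (ha _ _).1, nsmul_eq_mul, Nat.cast_ofNat]
      have h1 := hharm m n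
      have h2 := hharm m (n + 1)
      simp only [add_sub_cancel_right, sub_add_cancel] at h1 h2 ⊢
      linear_combination h1 - h2
    · simp only [Fin.mk_one, (ha _ _).2.1, nsmul_eq_mul, Nat.cast_ofNat]
      have h1 := hharm m n
      have h2 := hharm (m - 1) (n + 1)
      simp only [add_sub_cancel_right, sub_add_cancel] at h1 h2 ⊢
      linear_combination h2 - h1
    · simp only [Fin.reduceFinMk, (ha _ _).2.2, nsmul_eq_mul, Nat.cast_ofNat]
      have h1 := hharm m n
      have h2 := hharm (m - 1) n
      simp only [add_sub_cancel_right, sub_add_cancel] at h1 h2 ⊢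
      linear_combination h1 - h2
  ext ⟨s, γ⟩
  exact (hh s).eq_zero (hs s) γ

/-- The closed span `K` lies in the eigenspace, so `f` minus its projection to `K` is an
eigenfunction or zero, and it is orthogonal to every `hexagonFunction c`. -/
theorem mem_closure_span_hexagonFunction (hf : Δ f = (3 / 2 : ℂ) • f) :
    f ∈ (Submodule.span ℂ (Set.range hexagonFunction)).topologicalClosure := by
  set K := (Submodule.span ℂ (Set.range hexagonFunction)).topologicalClosure with hK
  have : CompleteSpace K :=
    (Submodule.isClosed_topologicalClosure _).completeSpace_coe
  set P : ℓ²(Vertex, ℂ) →L[ℂ] ℓ²(Vertex, ℂ) := Δ - (3 / 2 : ℂ) • 1 with hP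
  have hPiff : ∀ g, P g = 0 ↔ Δ g = (3 / 2 : ℂ) • g := fun g => by
    rw [hP, sub_apply, _root_.smul_apply, one_apply_eq_self, sub_eq_zero]
  have hKP : K ≤ P.ker := by
    refine Submodule.topologicalClosure_minimal _ (Submodule.span_le.2 ?_) P.isClosed_ker
    rintro _ ⟨c, rfl⟩
    exact (hPiff _).2 (Δ_hexagonFunction c)
  have hproj := Submodule.starProjection_apply_mem K f
  have horth := Submodule.sub_starProjection_mem_orthogonal (K := K) f
  have hzero : f - K.starProjection f = 0 := by
    refine eq_zero_of_inner_hexagonFunction ((hPiff _).1 ?_) fun c => ?_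
    · have h1 : P (K.starProjection f) = 0 := hKP hproj
      rw [map_sub, (hPiff f).2 hf, h1, sub_zero]
    · exact (Submodule.mem_orthogonal _ _).1 horth _
        (Submodule.le_topologicalClosure _ (Submodule.subset_span ⟨c, rfl⟩))
  rw [sub_eq_zero.1 hzero]
  exact hproj

end

end Kagome

end

theorem mainTheorem3 :
    -- the three bands are the eigenvalues, with multiplicities, of the pseudoperiodic Laplacians
    (∀ (θ : ℝ × ℝ) (E : ℝ), Module.finrank ℂ (Kagome.floquetEigenspace θ E)
      = Nat.card {k : Fin 3 // Kagome.band k θ = E}) ∧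
    -- the formulas for the integrated density of states, and its jump
    (∀ Q : Finset Kagome.Vertex, Kagome.IsFundamentalDomain Q →
      (∀ E : ℝ, Kagome.ids Q E
        = 1 / (3 * (2 * Real.pi) ^ 2) * ∑ k : Fin 3, Kagome.bandVolume k E) ∧
      (∀ E : ℝ, E < 0 → Kagome.ids Q E = 0) ∧
      (∀ E : ℝ, 0 ≤ E → E < 1 / 2 → Kagome.ids Q E
        = 2 / (3 * Real.pi ^ 2) * Kagome.arccosIntegral E (1 - 2 * E) 1) ∧
      (∀ E : ℝ, 1 / 2 ≤ E → E < 3 / 4 → Kagome.ids Q E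
        = 1 / 3 - 2 / (3 * Real.pi ^ 2) * Kagome.arccosIntegral E (2 * E - 2) (1 - 2 * E)) ∧
      (∀ E : ℝ, 3 / 4 ≤ E → E < 1 → Kagome.ids Q E
        = 1 / 3 + 2 / (3 * Real.pi ^ 2) * Kagome.arccosIntegral E (1 - 2 * E) (2 * E - 2)) ∧
      (∀ E : ℝ, 1 ≤ E → E < 3 / 2 → Kagome.ids Q E
        = 2 / 3 - 2 / (3 * Real.pi ^ 2) * Kagome.arccosIntegral E (2 * E - 2) 1) ∧
      (∀ E : ℝ, 3 / 2 ≤ E → Kagome.ids Q E = 1) ∧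
      Filter.Tendsto (Kagome.ids Q) (nhdsWithin (3 / 2) (Set.Iio (3 / 2))) (nhds (2 / 3))) ∧
    -- the eigenfunctions
    ∃ φ : ℤ × ℤ → lp (fun _ : Kagome.Vertex => ℂ) 2,
      -- on every hexagon, an eigenfunction with alternating values `1` and `-1`, which is unique up
      -- to scalars among all eigenfunctions supported on that hexagon
      (∀ c : ℤ × ℤ,
        (∀ v ∈ Kagome.hexagon c, φ c v = 1 ∨ φ c v = -1) ∧
        (∀ v ∈ Kagome.hexagon c, ∀ w ∈ Kagome.hexagon c,
          Kagome.graph.Adj v w → φ c w = -φ c v) ∧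
        (∀ v ∉ Kagome.hexagon c, φ c v = 0) ∧
        Kagome.Δ (φ c) = (3 / 2 : ℂ) • φ c ∧
        (∀ (E : ℂ) (f : lp (fun _ : Kagome.Vertex => ℂ) 2), Kagome.Δ f = E • f →
          (∀ v ∉ Kagome.hexagon c, f v = 0) → ∃ a : ℂ, f = a • φ c)) ∧
      -- every eigenfunction is a (finite or infinite) linear combination of these: it lies in their
      -- closed linear span, and it is pointwise a locally finite linear combination of them
      (∀ (E : ℂ) (f : lp (fun _ : Kagome.Vertex => ℂ) 2), f ≠ 0 → Kagome.Δ f = E • f →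
        E = 3 / 2 ∧
        f ∈ (Submodule.span ℂ (Set.range φ)).topologicalClosure ∧
        ∃ a : ℤ × ℤ → ℂ, ∀ v : Kagome.Vertex, HasSum (fun c => a c * φ c v) (f v)) := by
  refine ⟨Kagome.finrank_floquetEigenspace, fun Q hQ => ⟨Kagome.ids_eq_sum_bandVolume hQ,
    fun E => Kagome.ids_of_neg hQ, fun E => Kagome.ids_first hQ, fun E => Kagome.ids_second hQ,
    fun E => Kagome.ids_third hQ, fun E => Kagome.ids_fourth hQ, fun E => Kagome.ids_of_ge hQ,
    Kagome.tendsto_ids hQ⟩, Kagome.hexagonFunction, fun c =>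
    ⟨Kagome.hexagonFunction_eq_one_or c, Kagome.hexagonFunction_alternating c,
      fun v hv => Kagome.hexagonFunction_of_notMem hv, Kagome.Δ_hexagonFunction c,
      fun E f hf hs => Kagome.eq_smul_hexagonFunction c hf hs⟩, fun E f hf0 hf => ?_⟩
  obtain rfl := Kagome.eigenvalue_eq hf0 hf
  obtain ⟨a, ha⟩ := Kagome.exists_potential hf
  exact ⟨rfl, Kagome.mem_closure_span_hexagonFunction hf, a, Kagome.hasSum_hexagonFunction ha⟩
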